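/- Let $f_0:\mathbb{R}\to\mathbb{R}$ be an integrable differentiable function (for instance an equilibrium distribution function) whose derivative $f_0'$ is Hölder continuous on $\mathbb{R}$, i.e. $|f_0'(u)-f_0'(v)|\le C|u-v|^{\alpha}$ for all $u,v\in\mathbb{R}$, with some $\alpha>0$, $C\ge 0$. Then for every $u\in\mathbb{R}$ the Hilbert transform $$H[f_0'](u)=\frac1\pi\,\mathrm{PV}\!\int_{\mathbb{R}}\frac{f_0'(v)}{v-u}\,dv=\lim_{\varepsilon\to0^+,\,R\to\infty}\frac1\pi\int_{\varepsilon<|v-u|<R}\frac{f_0'(v)}{v-u}\,dv$$ exists, and the Penrose plot $$u\longmapsto 1-H[f_0'](u)-i f_0'(u),\qquad \infty\longmapsto 1,$$ is a continuous closed curve on $\mathbb{R}\cup\{\infty\}$. If it does not pass through the origin, then its winding number about the origin (the total increase, divided by $2\pi$, of a continuous argument along the curve as $u$ increases from $-\infty$ to $+\infty$) is well defined and nonnegative. The same holds for the curve $u\mapsto 1-\tilde H[f_0'](u)+i f_0'(u)$, $\infty\mapsto 1$, where $\tilde H=-H$ is the Hilbert transform with the opposite kernel, $\tilde H[f_0'](u)=\frac1\pi\mathrm{PV}\!\int_{\mathbb{R}}\frac{f_0'(v)}{u-v}\,dv$.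 -/

import Mathlib

open Filter Topology MeasureTheory
open scoped NNReal

noncomputable section

/-- The truncated Hilbert transform `(1/π) ∫_{ε < |v - u| < R} g(v) / (v - u) dv`. -/
def truncatedHilbert (g : ℝ → ℝ) (u ε R : ℝ) : ℝ :=
  (1 / Real.pi) * ∫ v in {v : ℝ | ε < |v - u| ∧ |v - u| < R}, g v / (v - u)

/-- The principal value `(1/π) PV ∫ g(v) / (v - u) dv` over the real line exists and equals `h`:
the truncated integrals converge to `h` as `ε → 0+` and `R → ∞`. -/
def HasHilbertTransformAt (g : ℝ → ℝ) (u h : ℝ) : Prop :=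
  Tendsto (fun p : ℝ × ℝ => truncatedHilbert g u p.1 p.2) (𝓝[>] 0 ×ˢ atTop) (𝓝 h)

/-- The Hilbert transform `H[g](u) = (1/π) PV ∫ g(v) / (v - u) dv`. -/
def hilbertTransform (g : ℝ → ℝ) (u : ℝ) : ℝ :=
  limUnder (𝓝[>] (0 : ℝ) ×ˢ (atTop : Filter ℝ))
    (fun p : ℝ × ℝ => truncatedHilbert g u p.1 p.2)

/-- The curve `γ` on the line, extended to the circle `ℝ ∪ {∞}` by the value `p` at `∞`. -/
def closeAtInfty (p : ℂ) (γ : ℝ → ℂ) : OnePoint ℝ → ℂ := fun x => x.elim p γ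

/-- The Penrose plot `u ↦ 1 - H[g](u) - i g(u)`, closed up by the value `1` at `u = ∞`.
It is the boundary value, from the upper half plane, of the plasma dispersion function
`z ↦ 1 - (1/π) ∫ g(v) / (v - z) dv`. -/
def penrosePlot (g : ℝ → ℝ) : OnePoint ℝ → ℂ :=
  closeAtInfty 1 fun u => 1 - (hilbertTransform g u : ℂ) - Complex.I * (g u : ℂ)

/-- The Penrose plot in the other usual convention for the Hilbert transform, with kernel
`1 / (u - v)`, that is `H'[g] = -H[g]`: the curve `u ↦ 1 - H'[g](u) + i g(u)`, closed up by the
value `1` at `u = ∞`. -/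
def penrosePlot' (g : ℝ → ℝ) : OnePoint ℝ → ℂ :=
  closeAtInfty 1 fun u => 1 - ((-hilbertTransform g u : ℝ) : ℂ) + Complex.I * (g u : ℂ)

/-- The curve `γ` on `ℝ ∪ {∞}`, traversed in the direction of increasing `u`, avoids `z` and has
winding number `n` about `z`: a continuous choice `θ` of the argument of `γ - z` along the real
line increases by `2πn` in total, from `u = -∞` to `u = +∞`. -/
def HasWindingNumber (γ : OnePoint ℝ → ℂ) (z : ℂ) (n : ℤ) : Prop :=
  Continuous γ ∧ (∀ x, γ x ≠ z) ∧
    ∃ θ : ℝ → ℝ, Continuous θ ∧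
      (∀ u : ℝ, γ u - z = (‖γ u - z‖ : ℂ) * Complex.exp (Complex.I * (θ u : ℂ))) ∧
      ∃ a b : ℝ, Tendsto θ atBot (𝓝 a) ∧ Tendsto θ atTop (𝓝 b) ∧ b - a = 2 * Real.pi * n

end

/-! The Penrose plot is the boundary curve of a function holomorphic in the upper half plane, so by
the argument principle its winding number counts zeros there. With `f` the profile and `g` its
derivative, that function is `D(z) = 1 - (1/π) ∫ f(v) / (v - z)² dv`, the dispersion function after
an integration by parts. This form is used because `f` is integrable, while `g` need not be.

Analysis: `D` has to extend continuously to the real axis and to `∞`. For `z = u + iε`, fold the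
integral at `u` and split `(t - iε)⁻²` into its even and odd parts. The even kernel has integral
zero, so `f` may be replaced by its second differences; Hölder continuity of `g` dominates these by
an integrable function, uniformly in `u` and `ε`. The odd kernel, after `t = εs`, averages means of
`g` against a fixed density of mass `π`. Both parts make sense at `ε = 0`, with values `π H[g](u)`
and `π g(u)` (`IsRegularProfile.dispersionFunction_ofReal`). Decay of `f` and `g` gives `D → 1` at
`∞`.

Topology: the Cayley transform carries `D` to a function continuous on the closed disc and
holomorphic inside. If it has no zero on the circle, its zeros are finite in number; dividing them
out leaves a zero-free factor with a continuous logarithm, of winding number 0, while each linear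
factor contributes 1 (`exists_hasWindingNumber_comp_cayleyCircle`). -/

/-! ### Winding numbers: uniqueness, products, exponentials. -/

theorem HasWindingNumber.unique {γ : OnePoint ℝ → ℂ} {z : ℂ} {m n : ℤ}
    (hm : HasWindingNumber γ z m) (hn : HasWindingNumber γ z n) : m = n := by
  obtain ⟨-, hne, θ, hθ, hθγ, a, b, ha, hb, hab⟩ := hm
  obtain ⟨-, -, η, hη, hηγ, c, d, hc, hd, hcd⟩ := hn
  have hpi : (2 * Real.pi) ≠ 0 := by positivity
  have hint : ∀ u, ∃ k : ℤ, (θ u - η u) / (2 * Real.pi) = k := by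
    intro u
    have h0 : ((‖γ u - z‖ : ℝ) : ℂ) ≠ 0 := by
      simpa [sub_eq_zero] using hne u
    have h1 := mul_left_cancel₀ h0 ((hθγ u).symm.trans (hηγ u))
    obtain ⟨k, hk⟩ := Complex.exp_eq_exp_iff_exists_int.1 h1
    refine ⟨k, ?_⟩
    have h2 := congrArg Complex.im hk
    simp at h2
    rw [div_eq_iff hpi, h2]
    ring
  choose k hk using hint
  -- Two continuous arguments differ by a continuous integer multiple of `2π`, which is constant on
  -- the connected line.
  have hkc : Continuous k := by
    rw [Int.isClosedEmbedding_coe_real.isEmbedding.continuous_iff]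
    have : (fun n : ℤ => (n : ℝ)) ∘ k = fun u => (θ u - η u) / (2 * Real.pi) := by
      ext u; exact (hk u).symm
    rw [this]
    fun_prop
  have hconst : ∀ u, θ u - η u = k 0 * (2 * Real.pi) := by
    intro u
    rw [← (PreconnectedSpace.constant inferInstance hkc : k u = k 0), ← hk u]
    field_simp
  have h1 : a - c = k 0 * (2 * Real.pi) :=
    tendsto_nhds_unique (ha.sub hc) (by simp only [hconst]; exact tendsto_const_nhds)
  have h2 : b - d = k 0 * (2 * Real.pi) :=
    tendsto_nhds_unique (hb.sub hd) (by simp only [hconst]; exact tendsto_const_nhds)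
  have h3 : 2 * Real.pi * (m : ℝ) = 2 * Real.pi * n := by linarith
  exact_mod_cast mul_left_cancel₀ hpi h3

theorem HasWindingNumber.mul {γ₁ γ₂ : OnePoint ℝ → ℂ} {m n : ℤ}
    (h₁ : HasWindingNumber γ₁ 0 m) (h₂ : HasWindingNumber γ₂ 0 n) :
    HasWindingNumber (fun x => γ₁ x * γ₂ x) 0 (m + n) := by
  obtain ⟨h₁c, hne₁, θ, hθ, hθγ, a, b, ha, hb, hab⟩ := h₁
  obtain ⟨h₂c, hne₂, η, hη, hηγ, c, d, hc, hd, hcd⟩ := h₂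
  refine ⟨h₁c.mul h₂c, fun x => mul_ne_zero (hne₁ x) (hne₂ x), fun u => θ u + η u,
    hθ.add hη, fun u => ?_, a + c, b + d, ha.add hc, hb.add hd, ?_⟩
  · have h1 := hθγ u
    have h2 := hηγ u
    simp only [sub_zero] at h1 h2 ⊢
    rw [norm_mul]
    push_cast
    rw [mul_add, Complex.exp_add]
    nth_rw 1 [h1, h2]
    ring
  · push_cast
    linarith

/-- `Im k` is an argument, and continuity of `k` at `∞` gives it the same limit at both ends of the
line. -/
theorem HasWindingNumber.of_exp {k γ : OnePoint ℝ → ℂ} (hk : Continuous k)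
    (hγ : ∀ x, Complex.exp (k x) = γ x) : HasWindingNumber γ 0 0 := by
  obtain rfl : γ = fun x => Complex.exp (k x) := funext fun x => (hγ x).symm
  obtain ⟨hinf, hc⟩ := (OnePoint.continuous_iff k).1 hk
  rw [coclosedCompact_eq_cocompact] at hinf
  have him := (Complex.continuous_im.tendsto _).comp hinf
  refine ⟨Complex.continuous_exp.comp hk, fun x => Complex.exp_ne_zero _, fun u => (k u).im,
    Complex.continuous_im.comp hc, fun u => ?_, _, _, him.mono_left atBot_le_cocompact,
    him.mono_left atTop_le_cocompact, by simp⟩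
  rw [sub_zero, Complex.norm_exp, Complex.ofReal_exp, ← Complex.exp_add]
  rw [mul_comm Complex.I, Complex.re_add_im]

/-! ### The unit circle as a closed curve on `ℝ ∪ {∞}`. -/

/-- The parametrization `u ↦ (u - i) / (u + i)`, `∞ ↦ 1` of the unit circle. -/
noncomputable def cayleyCircle : OnePoint ℝ → ℂ :=
  closeAtInfty 1 fun u => ((u : ℂ) - Complex.I) / ((u : ℂ) + Complex.I)

theorem ofReal_add_I_ne_zero (u : ℝ) : (u : ℂ) + Complex.I ≠ 0 := by
  intro h
  have := congrArg Complex.im h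
  simp at this

theorem cayleyCircle_coe (u : ℝ) :
    cayleyCircle (u : OnePoint ℝ) = ((u : ℂ) - Complex.I) / ((u : ℂ) + Complex.I) := rfl

theorem cayleyCircle_infty : cayleyCircle OnePoint.infty = 1 := rfl

theorem continuous_cayleyCircle : Continuous cayleyCircle := by
  rw [OnePoint.continuous_iff]
  constructor
  · rw [coclosedCompact_eq_cocompact, cayleyCircle_infty]
    have h1 : Tendsto (fun u : ℝ => (u : ℂ) + Complex.I) (cocompact ℝ) (cocompact ℂ) :=
      ((Homeomorph.addRight Complex.I).isClosedEmbedding.tendsto_cocompact).comp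
        Complex.isometry_ofReal.isClosedEmbedding.tendsto_cocompact
    have h2 : Tendsto (fun u : ℝ => 1 - 2 * Complex.I * ((u : ℂ) + Complex.I)⁻¹) (cocompact ℝ)
        (𝓝 (1 - 2 * Complex.I * 0)) :=
      ((tendsto_inv₀_cobounded.comp
        (by rw [Metric.cobounded_eq_cocompact]; exact h1)).const_mul _).const_sub _
    rw [mul_zero, sub_zero] at h2
    refine h2.congr fun u => ?_
    rw [cayleyCircle_coe]
    field_simp [ofReal_add_I_ne_zero u]
    ring
  · simp only [cayleyCircle_coe]
    exact Continuous.div (by fun_prop) (by fun_prop) ofReal_add_I_ne_zero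

theorem norm_cayleyCircle (x : OnePoint ℝ) : ‖cayleyCircle x‖ = 1 := by
  induction x using OnePoint.rec with
  | infty => simp [cayleyCircle_infty]
  | coe u =>
    rw [cayleyCircle_coe, norm_div, div_eq_one_iff_eq (by simpa using ofReal_add_I_ne_zero u)]
    rw [← Complex.norm_conj]
    simp [Complex.conj_ofReal]

theorem hasWindingNumber_cayleyCircle : HasWindingNumber cayleyCircle 0 1 := by
  refine ⟨continuous_cayleyCircle, fun x h => ?_, fun u => 2 * Real.arctan u + Real.pi,
    by fun_prop, fun u => ?_, 2 * -(Real.pi / 2) + Real.pi, 2 * (Real.pi / 2) + Real.pi,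
    ((Real.tendsto_arctan_atBot.mono_right nhdsWithin_le_nhds).const_mul 2).add_const _,
    ((Real.tendsto_arctan_atTop.mono_right nhdsWithin_le_nhds).const_mul 2).add_const _,
    by push_cast; ring⟩
  · simpa [h] using norm_cayleyCircle x
  · rw [sub_zero, norm_cayleyCircle, cayleyCircle_coe]
    -- Since `exp(i arctan u) = (1 + iu) / √(1 + u²)`, minus its square is `(u - i) / (u + i)`.
    have e1 : Complex.exp (Complex.I * ((2 * Real.arctan u + Real.pi : ℝ) : ℂ)) =
        -(Complex.exp (Real.arctan u * Complex.I)) ^ 2 := by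
      rw [← Complex.exp_nat_mul, ← mul_neg_one, ← Complex.exp_pi_mul_I, ← Complex.exp_add]
      congr 1
      push_cast
      ring
    rw [e1, Complex.exp_mul_I, ← Complex.ofReal_cos, ← Complex.ofReal_sin, Real.cos_arctan,
      Real.sin_arctan]
    have h0 := ofReal_add_I_ne_zero u
    have hs : (Real.sqrt (1 + u ^ 2) : ℂ) ^ 2 = 1 + u ^ 2 := by
      rw [← Complex.ofReal_pow, Real.sq_sqrt (by positivity)]
      push_cast
      rfl
    have hs0 : (Real.sqrt (1 + u ^ 2) : ℂ) ≠ 0 := by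
      have : 0 < Real.sqrt (1 + u ^ 2) := by positivity
      exact_mod_cast this.ne'
    have e2 : ((1 / Real.sqrt (1 + u ^ 2) : ℝ) : ℂ) + ((u / Real.sqrt (1 + u ^ 2) : ℝ) : ℂ) *
        Complex.I = (1 + u * Complex.I) / Real.sqrt (1 + u ^ 2) := by
      push_cast
      field_simp
    rw [e2, div_pow, hs]
    have h1 : (1 : ℂ) + u ^ 2 = (u + Complex.I) * (u - Complex.I) := by
      linear_combination Complex.I_sq
    have h2 : (1 : ℂ) + u * Complex.I = Complex.I * (u - Complex.I) := by
      linear_combination Complex.I_sq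
    have h3 : (u : ℂ) - Complex.I ≠ 0 := by
      intro h
      have := congrArg Complex.im h
      simp at this
    rw [h1, h2]
    field_simp
    simp

/-- On the unit circle `c - b = c (1 - b c̄)`, and the second factor stays within distance `‖b‖ < 1`
of 1, where the principal logarithm is continuous. -/
theorem hasWindingNumber_cayleyCircle_sub {b : ℂ} (hb : ‖b‖ < 1) :
    HasWindingNumber (fun x => cayleyCircle x - b) 0 1 := by
  have hre : ∀ x, 1 - b * (starRingEnd ℂ) (cayleyCircle x) ∈ Complex.slitPlane := by
    intro x
    rw [sub_eq_add_neg]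
    apply Complex.mem_slitPlane_of_norm_lt_one
    simpa [norm_cayleyCircle] using hb
  have h := hasWindingNumber_cayleyCircle.mul
    (HasWindingNumber.of_exp (k := fun x => Complex.log (1 - b * (starRingEnd ℂ) (cayleyCircle x)))
      (Continuous.clog (continuous_const.sub (continuous_const.mul
        (Complex.continuous_conj.comp continuous_cayleyCircle))) hre)
      fun x => Complex.exp_log (Complex.slitPlane_ne_zero (hre x)))
  rw [add_zero] at h
  convert h using 1
  ext x
  have : cayleyCircle x * (starRingEnd ℂ) (cayleyCircle x) = 1 := by
    rw [Complex.mul_conj, Complex.normSq_eq_norm_sq, norm_cayleyCircle]; simp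
  linear_combination b * this

/-! ### The argument principle on the closed disc. -/

theorem hasWindingNumber_comp_cayleyCircle_of_ne_zero {F : ℂ → ℂ}
    (hF : ContinuousOn F (Metric.closedBall 0 1)) (h0 : ∀ w ∈ Metric.closedBall 0 1, F w ≠ 0) :
    HasWindingNumber (fun x => F (cayleyCircle x)) 0 0 := by
  -- Radial retraction of the plane onto the closed disc: `F ∘ r` is continuous and zero-free on all
  -- of `ℂ`, so it has a continuous logarithm.
  let r : ℂ → ℂ := fun w => w / (max 1 ‖w‖ : ℝ)
  have hr : Continuous r := by
    refine Continuous.div continuous_id (by fun_prop) fun w => ?_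
    have : (0 : ℝ) < max 1 ‖w‖ := by positivity
    exact_mod_cast this.ne'
  have hrm : ∀ w, r w ∈ Metric.closedBall (0 : ℂ) 1 := by
    intro w
    have : (0 : ℝ) < max 1 ‖w‖ := by positivity
    rw [mem_closedBall_zero_iff, norm_div, Complex.norm_real, Real.norm_of_nonneg this.le,
      div_le_one this]
    exact le_max_right _ _
  have hsc : IsSimplyConnected (Set.univ : Set ℂ) := by
    have : ContractibleSpace (Set.univ : Set ℂ) :=
      convex_univ.contractibleSpace Set.univ_nonempty
    exact inferInstanceAs (SimplyConnectedSpace (Set.univ : Set ℂ))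
  obtain ⟨k, hk, hkF⟩ := Complex.exists_continuousOn_eqOn_exp_comp (U := (Set.univ : Set ℂ))
    (g := F ∘ r) hsc isOpen_univ
    (hF.comp_continuous hr hrm).continuousOn
    (by rintro ⟨w, -, hw⟩; exact h0 _ (hrm w) hw)
  rw [continuousOn_univ] at hk
  refine HasWindingNumber.of_exp (hk.comp continuous_cayleyCircle) fun x => ?_
  have := hkF (Set.mem_univ (cayleyCircle x))
  simpa [r, norm_cayleyCircle] using this

/-- The exponent is the order of vanishing at `b`, finite by `hiso`; it may be 0. Away from `b` the
cofactor is the plain quotient, so it inherits continuity up to the circle. -/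
theorem exists_factor_zero {F : ℂ → ℂ} {b : ℂ}
    (hF : ContinuousOn F (Metric.closedBall 0 1))
    (hd : DifferentiableOn ℂ F (Metric.ball 0 1)) (hb : b ∈ Metric.ball (0 : ℂ) 1)
    (hiso : ∃ᶠ w in 𝓝[≠] b, F w ≠ 0) :
    ∃ (n : ℕ) (F₁ : ℂ → ℂ), ContinuousOn F₁ (Metric.closedBall 0 1) ∧
      DifferentiableOn ℂ F₁ (Metric.ball 0 1) ∧ F₁ b ≠ 0 ∧ ∀ w, w ≠ b →
        F w = (w - b) ^ n * F₁ w := by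
  have han : AnalyticAt ℂ F b := hd.analyticAt (Metric.isOpen_ball.mem_nhds hb)
  obtain ⟨n, g, hg, hgb, hFg⟩ := han.exists_eventuallyEq_pow_smul_nonzero_iff.2
    (fun h => hiso ((h.filter_mono nhdsWithin_le_nhds).mono fun w hw => by simpa using hw))
  classical
  let F₁ : ℂ → ℂ := fun w => if w = b then g b else F w / (w - b) ^ n
  have hF₁ : ∀ w, w ≠ b → F₁ w = F w / (w - b) ^ n := fun w hw => by simp [F₁, hw]
  have hne : ∀ w, w ≠ b → (w - b) ^ n ≠ 0 := fun w hw => pow_ne_zero _ (sub_ne_zero.2 hw)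
  have hF₁g : F₁ =ᶠ[𝓝 b] g := by
    filter_upwards [hFg] with w hw
    by_cases h : w = b
    · simp [F₁, h]
    · rw [hF₁ w h, hw, smul_eq_mul, mul_div_cancel_left₀ _ (hne w h)]
  have hF₁loc : ∀ w, w ≠ b → F₁ =ᶠ[𝓝 w] fun w => F w / (w - b) ^ n := fun w hw => by
    filter_upwards [isOpen_ne.mem_nhds hw] with v hv using hF₁ v hv
  refine ⟨n, F₁, fun w hw => ?_, fun w hw => ?_, by simpa [F₁] using hgb, fun w hw => ?_⟩
  · by_cases h : w = b
    · subst h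
      exact (hg.continuousAt.congr hF₁g.symm).continuousWithinAt
    · refine ((hF w hw).div (by fun_prop) (hne w h)).congr_of_eventuallyEq
        ((hF₁loc w h).filter_mono nhdsWithin_le_nhds) (hF₁ w h)
  · by_cases h : w = b
    · subst h
      exact (hg.differentiableAt.congr_of_eventuallyEq hF₁g).differentiableWithinAt
    · refine ((hd w hw).div (by fun_prop) (hne w h)).congr_of_eventuallyEq
        ((hF₁loc w h).filter_mono nhdsWithin_le_nhds) (hF₁ w h)
  · rw [hF₁ w hw, mul_div_cancel₀ _ (hne w hw)]

/-- Only an inclusion of the zero set in `s` is asked for, so the induction can remove a point of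
`s` without knowing whether it is a zero. -/
theorem exists_hasWindingNumber_of_finite_zeros (s : Finset ℂ) : ∀ {F : ℂ → ℂ},
    ContinuousOn F (Metric.closedBall 0 1) → DifferentiableOn ℂ F (Metric.ball 0 1) →
    (∀ w ∈ Metric.closedBall 0 1, F w = 0 → w ∈ s) → ↑s ⊆ Metric.ball (0 : ℂ) 1 →
    ∃ n : ℕ, HasWindingNumber (fun x => F (cayleyCircle x)) 0 n := by
  classical
  induction s using Finset.induction_on with
  | empty =>
    intro F hF hd hz hs
    exact ⟨0, hasWindingNumber_comp_cayleyCircle_of_ne_zero hF fun w hw h => by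
      simpa using hz w hw h⟩
  | insert b s hbs ih =>
    intro F hF hd hz hs
    have hb : b ∈ Metric.ball (0 : ℂ) 1 := hs (by simp)
    have hiso : ∃ᶠ w in 𝓝[≠] b, F w ≠ 0 := by
      apply Eventually.frequently
      have h1 : ∀ᶠ w in 𝓝[≠] b, w ∈ Metric.ball (0 : ℂ) 1 :=
        nhdsWithin_le_nhds (Metric.isOpen_ball.mem_nhds hb)
      have h2 : ∀ᶠ w in 𝓝[≠] b, w ∉ s :=
        nhdsWithin_le_nhds (s.finite_toSet.isClosed.isOpen_compl.mem_nhds (by simpa using hbs))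
      filter_upwards [h1, h2, self_mem_nhdsWithin] with w hw1 hw2 hw3 h
      have := hz w (Metric.ball_subset_closedBall hw1) h
      rw [Finset.mem_insert] at this
      exact this.elim hw3 hw2
    obtain ⟨n, F₁, hF₁, hd₁, hF₁b, hFF₁⟩ := exists_factor_zero hF hd hb hiso
    obtain ⟨m, hm⟩ := ih hF₁ hd₁ (fun w hw h => by
      have hwb : w ≠ b := fun hwb => hF₁b (hwb ▸ h)
      have := hz w hw (by rw [hFF₁ w hwb, h, mul_zero])
      exact (Finset.mem_insert.1 this).resolve_left hwb) fun w hw => hs (by simp_all)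
    have hpow : ∀ k : ℕ, HasWindingNumber
        (fun x => (cayleyCircle x - b) ^ k * F₁ (cayleyCircle x)) 0 ((k + m : ℕ) : ℤ) := by
      intro k
      induction k with
      | zero => simpa using hm
      | succ k ihk =>
        have := (hasWindingNumber_cayleyCircle_sub (mem_ball_zero_iff.1 hb)).mul ihk
        convert this using 1
        · ext x; ring
        · push_cast; ring
    refine ⟨n + m, ?_⟩
    convert hpow n using 2 with x
    refine hFF₁ _ fun h => ?_
    rw [mem_ball_zero_iff, ← h, norm_cayleyCircle] at hb
    exact lt_irrefl _ hb

theorem exists_hasWindingNumber_comp_cayleyCircle {F : ℂ → ℂ}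
    (hF : ContinuousOn F (Metric.closedBall 0 1)) (hd : DifferentiableOn ℂ F (Metric.ball 0 1))
    (h0 : ∀ w ∈ Metric.sphere 0 1, F w ≠ 0) :
    ∃ n : ℕ, HasWindingNumber (fun x => F (cayleyCircle x)) 0 n := by
  let Z : Set ℂ := {w | w ∈ Metric.closedBall 0 1 ∧ F w = 0}
  have hZ : IsClosed Z := hF.preimage_isClosed_of_isClosed Metric.isClosed_closedBall
    isClosed_singleton
  have hZb : Z ⊆ Metric.ball 0 1 := fun w hw => by
    rw [mem_ball_zero_iff]
    refine lt_of_le_of_ne (mem_closedBall_zero_iff.1 hw.1) fun h => ?_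
    exact h0 w (mem_sphere_zero_iff_norm.2 h) hw.2
  have hZc : IsCompact Z := (isCompact_closedBall (0 : ℂ) 1).of_isClosed_subset hZ fun w hw => hw.1
  have han : AnalyticOnNhd ℂ F (Metric.ball 0 1) := hd.analyticOnNhd Metric.isOpen_ball
  -- Infinitely many zeros would accumulate in the compact set `Z`, hence inside the open disc; the
  -- identity theorem and continuity would then make `F` vanish on the circle.
  have hfin : Z.Finite := by
    by_contra hinf
    obtain ⟨b, hbZ, hb⟩ := Set.Infinite.exists_accPt_of_subset_isCompact hinf hZc subset_rfl
    have hfreq : ∃ᶠ w in 𝓝[≠] b, F w = 0 := by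
      rw [accPt_iff_frequently_nhdsNE] at hb
      exact hb.mono fun w hw => hw.2
    have heq : Set.EqOn F 0 (Metric.ball 0 1) :=
      han.eqOn_zero_of_preconnected_of_frequently_eq_zero
        (convex_ball (0 : ℂ) 1).isPreconnected (hZb hbZ) hfreq
    have heq' : Set.EqOn F 0 (Metric.closedBall 0 1) := by
      have := Set.EqOn.of_subset_closure heq hF (continuousOn_const (c := (0 : ℂ)))
        Metric.ball_subset_closedBall (by rw [closure_ball (0 : ℂ) one_ne_zero])
      exact this
    exact h0 1 (by simp) (heq' (by simp))
  exact exists_hasWindingNumber_of_finite_zeros hfin.toFinset hF hd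
    (fun w hw h => by simpa using (show w ∈ Z from ⟨hw, h⟩)) (by simpa using hZb)

/-! ### Decay at infinity of the profile and its derivative. -/

theorem exists_second_difference_eq {P f g : ℝ → ℝ} (hP : ∀ x, HasDerivAt P (f x) x)
    (hf : ∀ x, HasDerivAt f (g x) x) (u : ℝ) {h : ℝ} (hh : 0 < h) :
    ∃ ξ ∈ Set.Ioo u (u + 2 * h), P (u + h + h) - P (u + h) - (P (u + h) - P u) = h ^ 2 * g ξ := by
  have hd : ∀ x, HasDerivAt (fun x => P (x + h) - P x) (f (x + h) - f x) x := fun x =>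
    ((hP (x + h)).comp_add_const x h).sub (hP x)
  obtain ⟨ξ, hξ, hξ'⟩ := exists_hasDerivAt_eq_slope _ _ (lt_add_of_pos_right u hh)
    (fun x _ => (hd x).continuousAt.continuousWithinAt) fun x _ => hd x
  obtain ⟨η, hη, hη'⟩ := exists_hasDerivAt_eq_slope _ _ (lt_add_of_pos_right ξ hh)
    (fun x _ => (hf x).continuousAt.continuousWithinAt) fun x _ => hf x
  refine ⟨η, ⟨hξ.1.trans hη.1, by linarith [hξ.2, hη.2]⟩, ?_⟩
  rw [add_sub_cancel_left] at hξ' hη'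
  rw [eq_div_iff hh.ne'] at hξ' hη'
  rw [← hξ', ← hη']
  ring

theorem tendsto_deriv_zero_of_uniformContinuous {P f : ℝ → ℝ} {l : Filter ℝ} {L : ℝ}
    (hP : ∀ x, HasDerivAt P (f x) x) (hf : UniformContinuous f)
    (hl : ∀ h : ℝ, Tendsto (fun x => x + h) l l) (hPL : Tendsto P l (𝓝 L)) :
    Tendsto f l (𝓝 0) := by
  rw [Metric.tendsto_nhds]
  intro ε hε
  obtain ⟨δ, hδ, hfδ⟩ := Metric.uniformContinuous_iff.1 hf (ε / 2) (by positivity)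
  have h0 : Tendsto (fun u => (P (u + δ) - P u) / δ) l (𝓝 ((L - L) / δ)) :=
    ((hPL.comp (hl δ)).sub hPL).div_const δ
  rw [sub_self, zero_div, Metric.tendsto_nhds] at h0
  filter_upwards [h0 (ε / 2) (by positivity)] with u hu
  obtain ⟨ξ, hξ, hξ'⟩ := exists_hasDerivAt_eq_slope _ _ (lt_add_of_pos_right u hδ)
    (fun x _ => (hP x).continuousAt.continuousWithinAt) fun x _ => hP x
  rw [add_sub_cancel_left] at hξ'
  rw [← hξ'] at hu
  have h1 : dist (f u) (f ξ) < ε / 2 := hfδ (by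
    rw [Real.dist_eq, abs_lt]; constructor <;> linarith [hξ.1, hξ.2])
  linarith [dist_triangle (f u) (f ξ) 0]

/-- A Barbalat argument of second order: second differences of `P` tend to 0 and equal `h² g(ξ)`
with `ξ` near `u`, so uniform continuity carries the smallness from `ξ` to `u`. -/
theorem tendsto_second_deriv_zero_of_uniformContinuous {P f g : ℝ → ℝ} {l : Filter ℝ} {L : ℝ}
    (hP : ∀ x, HasDerivAt P (f x) x) (hf : ∀ x, HasDerivAt f (g x) x) (hg : UniformContinuous g)
    (hl : ∀ h : ℝ, Tendsto (fun x => x + h) l l) (hPL : Tendsto P l (𝓝 L)) :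
    Tendsto g l (𝓝 0) := by
  rw [Metric.tendsto_nhds]
  intro ε hε
  obtain ⟨δ, hδ, hgδ⟩ := Metric.uniformContinuous_iff.1 hg (ε / 2) (by positivity)
  -- The step is `δ / 2` because `ξ` ranges over an interval of twice the step.
  have hδ2 : 0 < δ / 2 := by positivity
  have h0 : Tendsto (fun u => (P (u + δ / 2 + δ / 2) - P (u + δ / 2) - (P (u + δ / 2) - P u)) /
      (δ / 2) ^ 2) l (𝓝 ((L - L - (L - L)) / (δ / 2) ^ 2)) := by
    have h1 := hPL.comp (hl (δ / 2))
    have h2 := h1.comp (hl (δ / 2))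
    exact ((h2.sub h1).sub (h1.sub hPL)).div_const _
  simp only [sub_self, zero_div, Metric.tendsto_nhds] at h0
  filter_upwards [h0 (ε / 2) (by positivity)] with u hu
  obtain ⟨ξ, hξ, hξ'⟩ := exists_second_difference_eq hP hf u hδ2
  rw [hξ', mul_div_cancel_left₀ _ (by positivity)] at hu
  have h1 : dist (g u) (g ξ) < ε / 2 := hgδ (by
    rw [Real.dist_eq, abs_lt]; constructor <;> linarith [hξ.1, hξ.2])
  linarith [dist_triangle (g u) (g ξ) 0]

theorem exists_norm_le_of_tendsto_zero_cocompact {g : ℝ → ℝ} (hg : Continuous g)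
    (h0 : Tendsto g (cocompact ℝ) (𝓝 0)) : ∃ M, ∀ x, |g x| ≤ M := by
  let F : ZeroAtInftyContinuousMap ℝ ℝ := ⟨⟨g, hg⟩, h0⟩
  exact ⟨‖F.toBCF‖, fun x => F.toBCF.norm_coe_le_norm x⟩

/-! ### Second differences and regular profiles. -/

/-- The symmetric second difference `f (u + t) + f (u - t) - 2 f u`. -/
def secondDiff (f : ℝ → ℝ) (u t : ℝ) : ℝ := f (u + t) + f (u - t) - 2 * f u

/-- The regularity of a profile `f` with derivative `g` from which the continuity of the Penrose
plot is derived. -/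
structure IsRegularProfile (f g : ℝ → ℝ) : Prop where
  hasDerivAt : ∀ x, HasDerivAt f (g x) x
  integrable : Integrable f
  continuous_deriv : Continuous g
  tendsto_zero : Tendsto f (cocompact ℝ) (𝓝 0)
  tendsto_deriv_zero : Tendsto g (cocompact ℝ) (𝓝 0)
  exists_dominating : ∃ b : ℝ → ℝ, IntegrableOn b (Set.Ioi 0) ∧
    ∀ u, ∀ t > 0, |secondDiff f u t| * (t ^ 2)⁻¹ ≤ b t

theorem abs_secondDiff_le_of_holder {f g : ℝ → ℝ} {C α : ℝ≥0} (hf : ∀ x, HasDerivAt f (g x) x)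
    (hg : HolderWith C α g) (u : ℝ) {t : ℝ} (ht : 0 < t) :
    |secondDiff f u t| ≤ t * (C * (2 * t) ^ (α : ℝ)) := by
  have hd : ∀ x, HasDerivAt (secondDiff f u) (g (u + x) - g (u - x)) x := fun x => by
    have := (((hf (u + x)).comp_const_add u x).add ((hf (u - x)).comp_const_sub u x)).sub_const
      (2 * f u)
    exact this
  obtain ⟨ξ, hξ, hξ'⟩ := exists_hasDerivAt_eq_slope _ _ ht
    (fun x _ => (hd x).continuousAt.continuousWithinAt) fun x _ => hd x
  have h0 : secondDiff f u 0 = 0 := by simp only [secondDiff, add_zero, sub_zero]; ring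
  rw [h0, sub_zero, sub_zero, eq_div_iff ht.ne'] at hξ'
  rw [← hξ', abs_mul, abs_of_pos ht, mul_comm]
  gcongr
  have h1 := hg.dist_le (u + ξ) (u - ξ)
  rw [Real.dist_eq, Real.dist_eq] at h1
  refine h1.trans ?_
  gcongr
  rw [abs_le]
  constructor <;> linarith [hξ.1, hξ.2]

theorem exists_dominating_secondDiff {f g : ℝ → ℝ} {C α : ℝ≥0} {K : ℝ}
    (hf : ∀ x, HasDerivAt f (g x) x) (hα : 0 < α) (hg : HolderWith C α g) (hK : ∀ x, |f x| ≤ K) :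
    ∃ b : ℝ → ℝ, IntegrableOn b (Set.Ioi 0) ∧
      ∀ u, ∀ t > 0, |secondDiff f u t| * (t ^ 2)⁻¹ ≤ b t := by
  -- Near 0 the Hölder bound gives an exponent above `-1`; far out, boundedness of `f` suffices.
  refine ⟨fun t => if t ≤ 1 then C * 2 ^ (α : ℝ) * t ^ ((α : ℝ) - 1) else 4 * K * t ^ (-2 : ℝ),
    ?_, fun u t ht => ?_⟩
  · rw [← Set.Ioc_union_Ioi_eq_Ioi zero_le_one]
    refine IntegrableOn.union ?_ ?_
    · have h : IntegrableOn (fun t : ℝ => C * 2 ^ (α : ℝ) * t ^ ((α : ℝ) - 1)) (Set.Ioc 0 1) := by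
        refine Integrable.const_mul ?_ _
        have := intervalIntegral.intervalIntegrable_rpow' (a := 0) (b := 1) (r := (α : ℝ) - 1)
          (by have : (0 : ℝ) < α := hα
              linarith)
        rwa [intervalIntegrable_iff_integrableOn_Ioc_of_le zero_le_one] at this
      exact h.congr_fun (fun t ht => by simp [ht.2]) measurableSet_Ioc
    · have h : IntegrableOn (fun t : ℝ => 4 * K * t ^ (-2 : ℝ)) (Set.Ioi 1) :=
        (integrableOn_Ioi_rpow_of_lt (by norm_num) one_pos).const_mul _
      exact h.congr_fun (fun t ht => by simp [not_le.2 (Set.mem_Ioi.1 ht)]) measurableSet_Ioi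
  · dsimp only
    split_ifs with h1
    · have := abs_secondDiff_le_of_holder hf hg u ht
      calc |secondDiff f u t| * (t ^ 2)⁻¹ ≤ t * (C * (2 * t) ^ (α : ℝ)) * (t ^ 2)⁻¹ := by gcongr
        _ = C * 2 ^ (α : ℝ) * t ^ ((α : ℝ) - 1) := by
          rw [Real.mul_rpow zero_le_two ht.le, Real.rpow_sub_one ht.ne']
          field_simp
    · have h2 : |secondDiff f u t| ≤ 4 * K := by
        rw [secondDiff, abs_le]
        have a1 := abs_le.1 (hK (u + t))
        have a2 := abs_le.1 (hK (u - t))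
        have a3 := abs_le.1 (hK u)
        constructor <;> linarith [a1.1, a2.1, a3.1, a1.2, a2.2, a3.2]
      rw [Real.rpow_neg ht.le, Real.rpow_two]
      gcongr

/-- The primitive of `f` converges at both ends. Decay of the derivative comes first, by second
differences; it makes `f` Lipschitz, which then yields decay of `f` itself. -/
theorem isRegularProfile_of_holderWith {f : ℝ → ℝ} {C α : ℝ≥0} (hint : Integrable f)
    (hdiff : Differentiable ℝ f) (hα : 0 < α) (hg : HolderWith C α (deriv f)) :
    IsRegularProfile f (deriv f) := by
  have hf : ∀ x, HasDerivAt f (deriv f x) x := fun x => (hdiff x).hasDerivAt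
  have huc : UniformContinuous (deriv f) := hg.uniformContinuous hα
  let P : ℝ → ℝ := fun u => ∫ x in (0 : ℝ)..u, f x
  have hP : ∀ x, HasDerivAt P (f x) x := fun x =>
    hdiff.continuous.integral_hasStrictDerivAt 0 x |>.hasDerivAt
  have hPtop : Tendsto P atTop (𝓝 (∫ x in Set.Ioi 0, f x)) :=
    intervalIntegral_tendsto_integral_Ioi 0 hint.integrableOn tendsto_id
  have hPbot : Tendsto P atBot (𝓝 (-∫ x in Set.Iic 0, f x)) := by
    refine (intervalIntegral_tendsto_integral_Iic 0 hint.integrableOn tendsto_id).neg.congr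
      fun u => ?_
    exact (intervalIntegral.integral_symm _ _).symm
  have htop : ∀ h : ℝ, Tendsto (fun x => x + h) atTop atTop := fun h =>
    tendsto_atTop_add_const_right _ h tendsto_id
  have hbot : ∀ h : ℝ, Tendsto (fun x => x + h) atBot atBot := fun h =>
    tendsto_atBot_add_const_right _ h tendsto_id
  have hg0 : Tendsto (deriv f) (cocompact ℝ) (𝓝 0) := by
    rw [cocompact_eq_atBot_atTop]
    exact (tendsto_second_deriv_zero_of_uniformContinuous hP hf huc hbot hPbot).sup
      (tendsto_second_deriv_zero_of_uniformContinuous hP hf huc htop hPtop)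
  obtain ⟨M, hM⟩ := exists_norm_le_of_tendsto_zero_cocompact huc.continuous hg0
  have hfuc : UniformContinuous f := by
    refine (lipschitzWith_of_nnnorm_deriv_le (C := M.toNNReal) hdiff fun x => ?_).uniformContinuous
    rw [← NNReal.coe_le_coe, coe_nnnorm]
    exact (hM x).trans (Real.le_coe_toNNReal M)
  have hf0 : Tendsto f (cocompact ℝ) (𝓝 0) := by
    rw [cocompact_eq_atBot_atTop]
    exact (tendsto_deriv_zero_of_uniformContinuous hP hfuc hbot hPbot).sup
      (tendsto_deriv_zero_of_uniformContinuous hP hfuc htop hPtop)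
  obtain ⟨K, hK⟩ := exists_norm_le_of_tendsto_zero_cocompact hdiff.continuous hf0
  exact ⟨hf, hint, huc.continuous, hf0, hg0, exists_dominating_secondDiff hf hα hg hK⟩

/-! ### The principal value as an integral of second differences. -/

theorem tendsto_intervalIntegral_nhdsGT_prod_atTop {h : ℝ → ℝ} (hh : IntegrableOn h (Set.Ioi 0)) :
    Tendsto (fun p : ℝ × ℝ => ∫ t in p.1..p.2, h t) (𝓝[>] 0 ×ˢ atTop)
      (𝓝 (∫ t in Set.Ioi 0, h t)) := by
  have hi : ∀ x : ℝ, 0 ≤ x → IntervalIntegrable h volume 0 x := fun x hx => by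
    rw [intervalIntegrable_iff_integrableOn_Ioc_of_le hx]
    exact hh.mono_set Set.Ioc_subset_Ioi_self
  have h1 : Tendsto (fun p : ℝ × ℝ => ∫ t in (0 : ℝ)..p.2, h t) (𝓝[>] 0 ×ˢ atTop)
      (𝓝 (∫ t in Set.Ioi 0, h t)) := intervalIntegral_tendsto_integral_Ioi 0 hh tendsto_snd
  have h2 : Tendsto (fun x : ℝ => ∫ t in (0 : ℝ)..x, h t) (𝓝[>] 0) (𝓝 0) := by
    -- Nothing is known of `h` on the negative axis, so it is cut off there before its primitive is
    -- used.
    have hc : Continuous fun x : ℝ => ∫ t in (0 : ℝ)..x, (Set.Ioi 0).indicator h t :=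
      intervalIntegral.continuous_primitive
        (fun a b => (hh.integrable_indicator measurableSet_Ioi).intervalIntegrable) 0
    have h3 := (hc.tendsto 0).mono_left (nhdsWithin_le_nhds (s := Set.Ioi 0))
    rw [intervalIntegral.integral_same] at h3
    refine h3.congr' ?_
    filter_upwards [self_mem_nhdsWithin] with x hx
    refine intervalIntegral.integral_congr_ae (ae_of_all _ fun t ht => ?_)
    rw [Set.uIoc_of_le (le_of_lt hx)] at ht
    exact Set.indicator_of_mem ht.1 _
  have h4 := h1.sub (h2.comp tendsto_fst)
  rw [sub_zero] at h4
  refine h4.congr' ?_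
  have hpos : ∀ᶠ p : ℝ × ℝ in 𝓝[>] 0 ×ˢ atTop, 0 < p.1 ∧ 0 < p.2 :=
    (tendsto_fst.eventually self_mem_nhdsWithin).and
      (tendsto_snd.eventually (eventually_gt_atTop 0))
  filter_upwards [hpos] with p hp
  exact intervalIntegral.integral_interval_sub_left (hi _ hp.2.le) (hi _ hp.1.le)

theorem hasDerivAt_secondDiff {f g : ℝ → ℝ} (hf : ∀ x, HasDerivAt f (g x) x) (u x : ℝ) :
    HasDerivAt (secondDiff f u) (g (u + x) - g (u - x)) x :=
  (((hf (u + x)).comp_const_add u x).add ((hf (u - x)).comp_const_sub u x)).sub_const (2 * f u)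

theorem secondDiff_zero (f : ℝ → ℝ) (u : ℝ) : secondDiff f u 0 = 0 := by
  simp only [secondDiff, add_zero, sub_zero]; ring

theorem truncatedHilbert_eq_intervalIntegral {g : ℝ → ℝ} (hg : Continuous g) (u : ℝ) {ε R : ℝ}
    (hε : 0 < ε) (hR : ε < R) :
    truncatedHilbert g u ε R = (1 / Real.pi) * ∫ t in ε..R, (g (u + t) - g (u - t)) * t⁻¹ := by
  have hset : {v : ℝ | ε < |v - u| ∧ |v - u| < R} =
      Set.Ioo (u - R) (u - ε) ∪ Set.Ioo (u + ε) (u + R) := by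
    ext v
    simp only [Set.mem_ofPred_eq, Set.mem_union, Set.mem_Ioo]
    constructor
    · rintro ⟨h1, h2⟩
      rw [abs_lt] at h2
      rcases lt_abs.1 h1 with h | h
      · right; constructor <;> linarith
      · left; constructor <;> linarith
    · rintro (⟨h1, h2⟩ | ⟨h1, h2⟩)
      · rw [abs_of_neg (by linarith)]; constructor <;> linarith
      · rw [abs_of_pos (by linarith)]; constructor <;> linarith
  have hi1 : IntervalIntegrable (fun t => g (u + t) * t⁻¹) volume ε R := by
    refine ContinuousOn.intervalIntegrable (ContinuousOn.mul (by fun_prop)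
      (continuousOn_inv₀.mono fun t ht => ?_))
    rw [Set.uIcc_of_le hR.le] at ht
    exact (hε.trans_le ht.1).ne'
  have hi2 : IntervalIntegrable (fun t => g (u - t) * t⁻¹) volume ε R := by
    refine ContinuousOn.intervalIntegrable (ContinuousOn.mul (by fun_prop)
      (continuousOn_inv₀.mono fun t ht => ?_))
    rw [Set.uIcc_of_le hR.le] at ht
    exact (hε.trans_le ht.1).ne'
  have hc1 : IntegrableOn (fun v => g v / (v - u)) (Set.Ioo (u - R) (u - ε)) := by
    refine (ContinuousOn.integrableOn_Icc (ContinuousOn.div (by fun_prop) (by fun_prop)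
      fun v hv => ?_)).mono_set Set.Ioo_subset_Icc_self
    have := hv.2
    exact (by linarith : v - u < 0).ne
  have hc2 : IntegrableOn (fun v => g v / (v - u)) (Set.Ioo (u + ε) (u + R)) := by
    refine (ContinuousOn.integrableOn_Icc (ContinuousOn.div (by fun_prop) (by fun_prop)
      fun v hv => ?_)).mono_set Set.Ioo_subset_Icc_self
    have := hv.1
    exact (by linarith : 0 < v - u).ne'
  rw [truncatedHilbert, hset, setIntegral_union (Set.disjoint_left.2 fun v h1 h2 => by
    linarith [h1.2, h2.1]) measurableSet_Ioo hc1 hc2, ← integral_Ioc_eq_integral_Ioo,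
    ← integral_Ioc_eq_integral_Ioo, ← intervalIntegral.integral_of_le (by linarith),
    ← intervalIntegral.integral_of_le (by linarith)]
  congr 1
  have e1 := intervalIntegral.integral_comp_add_left (a := ε) (b := R)
    (fun v => g v / (v - u)) u
  have e2 := intervalIntegral.integral_comp_sub_left (a := ε) (b := R)
    (fun v => g v / (v - u)) u
  rw [← e1, ← e2, ← intervalIntegral.integral_add]
  · refine intervalIntegral.integral_congr fun t _ => ?_
    simp only [add_sub_cancel_left, sub_sub_cancel_left, div_eq_mul_inv]
    ring
  · simpa [div_eq_mul_inv, Pi.neg_def] using hi2.neg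
  · simpa [div_eq_mul_inv] using hi1

/-- The folded increment of `g` is the `t`-derivative of the second difference. In the limit both
boundary terms vanish: at `R` because `f` decays, at `ε` because the second difference has zero
value and derivative at 0. -/
theorem intervalIntegral_mul_inv_by_parts {f g : ℝ → ℝ} (hf : ∀ x, HasDerivAt f (g x) x)
    (hg : Continuous g) (u : ℝ) {ε R : ℝ} (hε : 0 < ε) (hR : ε < R) :
    ∫ t in ε..R, (g (u + t) - g (u - t)) * t⁻¹ =
      secondDiff f u R / R - secondDiff f u ε / ε + ∫ t in ε..R, secondDiff f u t * (t ^ 2)⁻¹ := by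
  have hpos : ∀ t ∈ Set.uIcc ε R, t ≠ 0 := fun t ht => by
    rw [Set.uIcc_of_le hR.le] at ht
    exact (hε.trans_le ht.1).ne'
  have hcF : Continuous (secondDiff f u) := continuous_iff_continuousAt.2 fun x =>
    (hasDerivAt_secondDiff hf u x).continuousAt
  have := intervalIntegral.integral_deriv_mul_eq_sub (a := ε) (b := R)
    (u := secondDiff f u) (v := fun t => t⁻¹) (u' := fun t => g (u + t) - g (u - t))
    (v' := fun t => -(t ^ 2)⁻¹) (fun t _ => hasDerivAt_secondDiff hf u t)
    (fun t ht => hasDerivAt_inv (hpos t ht)) (Continuous.intervalIntegrable (by fun_prop) _ _)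
    (ContinuousOn.intervalIntegrable (ContinuousOn.neg (ContinuousOn.inv₀ (by fun_prop)
      fun t ht => pow_ne_zero 2 (hpos t ht))))
  rw [intervalIntegral.integral_add] at this
  · simp only [mul_neg, intervalIntegral.integral_neg] at this
    rw [div_eq_mul_inv, div_eq_mul_inv]
    linarith
  · exact ContinuousOn.intervalIntegrable (ContinuousOn.mul (by fun_prop)
      (ContinuousOn.inv₀ (by fun_prop) hpos))
  · exact ContinuousOn.intervalIntegrable (ContinuousOn.mul hcF.continuousOn
      (ContinuousOn.neg (ContinuousOn.inv₀ (by fun_prop) fun t ht => pow_ne_zero 2 (hpos t ht))))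

/-! ### The two parts of the Cauchy integral, up to the boundary. -/

/-- The convolution of the second differences with the even kernel `Re (t - iε)⁻²`. -/
noncomputable def normalPart (f : ℝ → ℝ) (u ε : ℝ) : ℝ :=
  ∫ t in Set.Ioi 0, secondDiff f u t * ((t ^ 2 - ε ^ 2) / (t ^ 2 + ε ^ 2) ^ 2)

/-- The mean value of `g` over the interval with centre `u` and radius `h`. -/
noncomputable def intervalMean (g : ℝ → ℝ) (u h : ℝ) : ℝ :=
  ∫ r in (-1 : ℝ)..1, g (u + h * r) / 2

/-- The rescaled convolution of the mean values of `g` with the odd kernel `Im (t - iε)⁻²`. -/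
noncomputable def tangentialPart (g : ℝ → ℝ) (u ε : ℝ) : ℝ :=
  ∫ s in Set.Ioi 0, intervalMean g u (ε * s) * (4 * s ^ 2 / (1 + s ^ 2) ^ 2)

/-- The bound does not depend on `ε`, so one dominating function serves all heights, including `ε =
0`. -/
theorem abs_even_kernel_le {t : ℝ} (ht : 0 < t) (ε : ℝ) :
    |(t ^ 2 - ε ^ 2) / (t ^ 2 + ε ^ 2) ^ 2| ≤ (t ^ 2)⁻¹ := by
  have h1 : 0 < t ^ 2 + ε ^ 2 := by positivity
  have h2 : |t ^ 2 - ε ^ 2| ≤ t ^ 2 + ε ^ 2 := by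
    rw [abs_le]; constructor <;> nlinarith [sq_nonneg t, sq_nonneg ε]
  rw [abs_div, abs_of_nonneg (sq_nonneg (t ^ 2 + ε ^ 2)), div_le_iff₀ (by positivity)]
  calc |t ^ 2 - ε ^ 2| ≤ t ^ 2 + ε ^ 2 := h2
    _ ≤ (t ^ 2)⁻¹ * (t ^ 2 + ε ^ 2) * (t ^ 2 + ε ^ 2) := by
      refine le_mul_of_one_le_left h1.le ?_
      rw [← div_eq_inv_mul, one_le_div (by positivity)]
      nlinarith [sq_nonneg ε]
    _ = _ := by ring

theorem hasDerivAt_odd_kernel_primitive (s : ℝ) :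
    HasDerivAt (fun s => 2 * (Real.arctan s - s / (1 + s ^ 2))) (4 * s ^ 2 / (1 + s ^ 2) ^ 2) s := by
  have h0 : (1 + s ^ 2) ≠ 0 := by positivity
  have := ((Real.hasDerivAt_arctan s).sub ((hasDerivAt_id s).div
    (((hasDerivAt_id s).pow 2).const_add 1) h0)).const_mul 2
  refine this.congr_deriv ?_
  simp
  field_simp
  ring

theorem tendsto_div_one_add_sq : Tendsto (fun s : ℝ => s / (1 + s ^ 2)) atTop (𝓝 0) := by
  refine squeeze_zero' (g := fun s : ℝ => s⁻¹) ?_ ?_ tendsto_inv_atTop_zero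
  · filter_upwards [eventually_gt_atTop 0] with s hs
    positivity
  · filter_upwards [eventually_gt_atTop 0] with s hs
    rw [div_le_iff₀ (by positivity), ← div_eq_inv_mul, le_div_iff₀ hs]
    nlinarith

theorem tendsto_odd_kernel_primitive :
    Tendsto (fun s => 2 * (Real.arctan s - s / (1 + s ^ 2))) atTop (𝓝 Real.pi) := by
  have := ((Real.tendsto_arctan_atTop.mono_right nhdsWithin_le_nhds).sub
    tendsto_div_one_add_sq).const_mul 2
  convert this using 2
  ring

theorem integrableOn_odd_kernel :
    IntegrableOn (fun s : ℝ => 4 * s ^ 2 / (1 + s ^ 2) ^ 2) (Set.Ioi 0) :=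
  integrableOn_Ioi_deriv_of_nonneg' (fun s _ => hasDerivAt_odd_kernel_primitive s)
    (fun s _ => by positivity) tendsto_odd_kernel_primitive

theorem integral_odd_kernel :
    ∫ s in Set.Ioi (0 : ℝ), 4 * s ^ 2 / (1 + s ^ 2) ^ 2 = Real.pi := by
  rw [integral_Ioi_of_hasDerivAt_of_nonneg' (fun s _ => hasDerivAt_odd_kernel_primitive s)
    (fun s _ => by positivity) tendsto_odd_kernel_primitive]
  simp

theorem tangentialPart_zero (g : ℝ → ℝ) (u : ℝ) : tangentialPart g u 0 = Real.pi * g u := by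
  have : ∀ s : ℝ, intervalMean g u (0 * s) = g u := fun s => by
    simp [intervalMean]
    ring
  simp only [tangentialPart, this]
  rw [integral_const_mul, integral_odd_kernel, mul_comm]

theorem normalPart_zero (f : ℝ → ℝ) (u : ℝ) :
    normalPart f u 0 = ∫ t in Set.Ioi 0, secondDiff f u t * (t ^ 2)⁻¹ := by
  refine setIntegral_congr_fun measurableSet_Ioi fun t ht => ?_
  have : t ≠ 0 := (Set.mem_Ioi.1 ht).ne'
  congr 1
  field_simp
  ring

theorem continuous_intervalMean {g : ℝ → ℝ} (hg : Continuous g) :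
    Continuous fun p : ℝ × ℝ => intervalMean g p.1 p.2 :=
  intervalIntegral.continuous_parametric_intervalIntegral_of_continuous'
    (f := fun (p : ℝ × ℝ) r => g (p.1 + p.2 * r) / 2) (by fun_prop) _ _

theorem abs_intervalMean_le {g : ℝ → ℝ} {M : ℝ} (hM : ∀ x, |g x| ≤ M) (u h : ℝ) :
    |intervalMean g u h| ≤ M := by
  have := intervalIntegral.norm_integral_le_of_norm_le_const (a := -1) (b := 1) (C := M / 2)
    (f := fun r => g (u + h * r) / 2) fun r _ => by
      rw [Real.norm_eq_abs, abs_div, abs_two]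
      have := hM (u + h * r)
      gcongr
  refine this.trans (le_of_eq ?_)
  norm_num

theorem continuous_tangentialPart {g : ℝ → ℝ} {M : ℝ} (hg : Continuous g)
    (hM : ∀ x, |g x| ≤ M) : Continuous fun p : ℝ × ℝ => tangentialPart g p.1 p.2 := by
  have hc := continuous_intervalMean hg
  refine continuous_of_dominated (bound := fun s => M * (4 * s ^ 2 / (1 + s ^ 2) ^ 2))
    (fun p => ?_) (fun p => ae_of_all _ fun s => ?_) (integrableOn_odd_kernel.const_mul M)
    (ae_of_all _ fun s => ?_)
  · refine Continuous.aestronglyMeasurable (Continuous.mul ?_ (Continuous.div (by fun_prop)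
      (by fun_prop) fun s => by positivity))
    exact hc.comp (f := fun s => (p.1, p.2 * s)) (by fun_prop)
  · rw [norm_mul, Real.norm_of_nonneg (r := 4 * s ^ 2 / (1 + s ^ 2) ^ 2) (by positivity)]
    gcongr
    exact abs_intervalMean_le hM _ _
  · refine Continuous.mul ?_ continuous_const
    exact hc.comp (f := fun p : ℝ × ℝ => (p.1, p.2 * s)) (by fun_prop)

theorem continuous_secondDiff {f : ℝ → ℝ} (hf : Continuous f) :
    Continuous fun p : ℝ × ℝ => secondDiff f p.1 p.2 := by
  unfold secondDiff
  fun_prop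

theorem aestronglyMeasurable_normalPart_integrand {f : ℝ → ℝ} (hf : Continuous f) (u ε : ℝ)
    (μ : Measure ℝ) :
    AEStronglyMeasurable
      (fun t => secondDiff f u t * ((t ^ 2 - ε ^ 2) / (t ^ 2 + ε ^ 2) ^ 2)) μ := by
  have h1 : Measurable (secondDiff f u) :=
    ((continuous_secondDiff hf).comp (f := fun t => (u, t)) (by fun_prop)).measurable
  exact (h1.mul (by fun_prop)).aestronglyMeasurable

theorem norm_normalPart_integrand_le {f b : ℝ → ℝ}
    (hb : ∀ u, ∀ t > 0, |secondDiff f u t| * (t ^ 2)⁻¹ ≤ b t) (u ε : ℝ) {t : ℝ} (ht : 0 < t) :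
    ‖secondDiff f u t * ((t ^ 2 - ε ^ 2) / (t ^ 2 + ε ^ 2) ^ 2)‖ ≤ b t := by
  rw [norm_mul]
  exact (mul_le_mul_of_nonneg_left (abs_even_kernel_le ht ε) (norm_nonneg _)).trans (hb u t ht)

theorem continuous_normalPart {f b : ℝ → ℝ} (hf : Continuous f) (hbi : IntegrableOn b (Set.Ioi 0))
    (hb : ∀ u, ∀ t > 0, |secondDiff f u t| * (t ^ 2)⁻¹ ≤ b t) :
    Continuous fun p : ℝ × ℝ => normalPart f p.1 p.2 := by
  refine continuous_of_dominated
    (fun p => aestronglyMeasurable_normalPart_integrand hf p.1 p.2 _)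
    (fun p => ?_) hbi ?_
  · filter_upwards [ae_restrict_mem measurableSet_Ioi] with t ht
    exact norm_normalPart_integrand_le hb _ _ ht
  · filter_upwards [ae_restrict_mem measurableSet_Ioi] with t ht
    have ht : 0 < t := ht
    refine Continuous.mul ((continuous_secondDiff hf).comp (f := fun p : ℝ × ℝ => (p.1, t))
      (by fun_prop)) (Continuous.div (by fun_prop) (by fun_prop) fun p => by positivity)

theorem hasHilbertTransformAt_normalPart {f g b : ℝ → ℝ} (hf : ∀ x, HasDerivAt f (g x) x)
    (hg : Continuous g) (hf0 : Tendsto f (cocompact ℝ) (𝓝 0))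
    (hbi : IntegrableOn b (Set.Ioi 0))
    (hb : ∀ u, ∀ t > 0, |secondDiff f u t| * (t ^ 2)⁻¹ ≤ b t) (u : ℝ) :
    HasHilbertTransformAt g u (1 / Real.pi * normalPart f u 0) := by
  have hfc : Continuous f := continuous_iff_continuousAt.2 fun x => (hf x).continuousAt
  have hint : IntegrableOn (fun t => secondDiff f u t * (t ^ 2)⁻¹) (Set.Ioi 0) := by
    have h1 : Measurable (secondDiff f u) :=
      ((continuous_secondDiff hfc).comp (f := fun t => (u, t)) (by fun_prop)).measurable
    refine Integrable.mono' hbi (h1.mul (by fun_prop)).aestronglyMeasurable ?_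
    filter_upwards [ae_restrict_mem measurableSet_Ioi] with t ht
    rw [norm_mul, Real.norm_of_nonneg (r := (t ^ 2)⁻¹) (by positivity)]
    exact hb u t ht
  have hR : Tendsto (fun R => secondDiff f u R / R) atTop (𝓝 0) := by
    have hp : Tendsto (fun R => f (u + R)) atTop (𝓝 0) :=
      (hf0.mono_left atTop_le_cocompact).comp (tendsto_atTop_add_const_left _ u tendsto_id)
    have hm : Tendsto (fun R => f (u - R)) atTop (𝓝 0) :=
      (hf0.mono_left atBot_le_cocompact).comp
        (tendsto_atBot_add_const_left _ u tendsto_neg_atTop_atBot)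
    exact ((hp.add hm).sub_const _).div_atTop tendsto_id
  have hε : Tendsto (fun ε => secondDiff f u ε / ε) (𝓝[>] 0) (𝓝 0) := by
    have h1 := (hasDerivAt_iff_tendsto_slope.1 (hasDerivAt_secondDiff hf u 0)).mono_left
      (nhdsWithin_mono (0 : ℝ) (s := Set.Ioi 0) fun x hx => (Set.mem_Ioi.1 hx).ne')
    rw [add_zero, sub_zero, sub_self] at h1
    refine h1.congr fun ε => ?_
    rw [slope_def_field, secondDiff_zero, sub_zero, sub_zero]
  have hlim := ((((hR.comp tendsto_snd).sub (hε.comp tendsto_fst)).add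
    (tendsto_intervalIntegral_nhdsGT_prod_atTop hint)).const_mul (1 / Real.pi))
  rw [sub_zero, zero_add, ← normalPart_zero] at hlim
  refine hlim.congr' ?_
  have hev : ∀ᶠ p : ℝ × ℝ in 𝓝[>] 0 ×ˢ atTop, (0 < p.1 ∧ p.1 < 1) ∧ 1 < p.2 :=
    (tendsto_fst.eventually (Ioo_mem_nhdsGT one_pos)).and
      (tendsto_snd.eventually (eventually_gt_atTop 1))
  filter_upwards [hev] with p hp
  rw [truncatedHilbert_eq_intervalIntegral hg u hp.1.1 (hp.1.2.trans hp.2),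
    intervalIntegral_mul_inv_by_parts hf hg u hp.1.1 (hp.1.2.trans hp.2)]
  rfl

theorem HasHilbertTransformAt.hilbertTransform_eq {g : ℝ → ℝ} {u h : ℝ}
    (hg : HasHilbertTransformAt g u h) : hilbertTransform g u = h :=
  Tendsto.limUnder_eq hg

/-! ### The Cauchy integral in the open upper half plane. -/

theorem integrable_inv_sq_add_sq {ε : ℝ} (hε : 0 < ε) :
    Integrable fun t : ℝ => (t ^ 2 + ε ^ 2)⁻¹ := by
  refine ((integrable_inv_one_add_sq.comp_div hε.ne').const_mul (ε ^ 2)⁻¹).congr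
    (ae_of_all _ fun t => ?_)
  simp only
  field_simp
  ring

/-- The primitive `-t / (t² + ε²)` vanishes at both ends. This is what allows `2 f(u)` to be
subtracted in `normalPart`. -/
theorem integral_even_kernel {ε : ℝ} (hε : 0 < ε) :
    IntegrableOn (fun t : ℝ => (t ^ 2 - ε ^ 2) / (t ^ 2 + ε ^ 2) ^ 2) (Set.Ioi 0) ∧
      ∫ t in Set.Ioi (0 : ℝ), (t ^ 2 - ε ^ 2) / (t ^ 2 + ε ^ 2) ^ 2 = 0 := by
  have hi : IntegrableOn (fun t : ℝ => (t ^ 2 - ε ^ 2) / (t ^ 2 + ε ^ 2) ^ 2) (Set.Ioi 0) := by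
    refine Integrable.mono' (integrable_inv_sq_add_sq hε).integrableOn
      (Measurable.aestronglyMeasurable (by fun_prop)) (ae_of_all _ fun t => ?_)
    have h1 : 0 < t ^ 2 + ε ^ 2 := by positivity
    have h2 : |t ^ 2 - ε ^ 2| ≤ t ^ 2 + ε ^ 2 := by
      rw [abs_le]; constructor <;> nlinarith [sq_nonneg t, sq_nonneg ε]
    rw [Real.norm_eq_abs, abs_div, abs_of_nonneg (sq_nonneg (t ^ 2 + ε ^ 2)),
      div_le_iff₀ (by positivity), pow_two (t ^ 2 + ε ^ 2), inv_mul_cancel_left₀ h1.ne']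
    exact h2
  have hd : ∀ t ∈ Set.Ici (0 : ℝ), HasDerivAt (fun t => -(t / (t ^ 2 + ε ^ 2)))
      ((t ^ 2 - ε ^ 2) / (t ^ 2 + ε ^ 2) ^ 2) t := fun t _ => by
    have h0 : t ^ 2 + ε ^ 2 ≠ 0 := by positivity
    refine ((hasDerivAt_id t).div (((hasDerivAt_id t).pow 2).add_const (ε ^ 2)) h0).neg.congr_deriv
      ?_
    simp
    field_simp
    ring
  have hl : Tendsto (fun t : ℝ => -(t / (t ^ 2 + ε ^ 2))) atTop (𝓝 0) := by
    rw [← neg_zero]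
    refine (squeeze_zero' (g := fun s : ℝ => s⁻¹) ?_ ?_ tendsto_inv_atTop_zero).neg
    · filter_upwards [eventually_gt_atTop 0] with s hs
      positivity
    · filter_upwards [eventually_gt_atTop 0] with s hs
      rw [div_le_iff₀ (by positivity), ← div_eq_inv_mul, le_div_iff₀ hs]
      nlinarith [sq_nonneg ε]
  refine ⟨hi, ?_⟩
  rw [integral_Ioi_of_hasDerivAt_of_tendsto' hd hi hl]
  simp

theorem intervalMean_eq {f g : ℝ → ℝ} (hf : ∀ x, HasDerivAt f (g x) x) (hg : Continuous g)
    (u : ℝ) {h : ℝ} (hh : h ≠ 0) : intervalMean g u h = (f (u + h) - f (u - h)) / (2 * h) := by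
  have hd : ∀ r ∈ Set.uIcc (-1 : ℝ) 1,
      HasDerivAt (fun r => f (u + h * r) / (2 * h)) (g (u + h * r) / 2) r := fun r _ => by
    have h1 : HasDerivAt (fun r => u + h * r) h r := by
      simpa using ((hasDerivAt_id r).const_mul h).const_add u
    refine (((hf (u + h * r)).comp r h1).div_const (2 * h)).congr_deriv ?_
    field_simp
  rw [intervalMean, intervalIntegral.integral_eq_sub_of_hasDerivAt hd
    (Continuous.intervalIntegrable (by fun_prop) _ _)]
  simp only [mul_one, mul_neg, ← sub_eq_add_neg]
  ring

/-- Substitute `t = εs`: the symmetric difference quotient of `f` is a mean of `g`, and the factor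
`2εs` taken from it turns the kernel into one free of `ε`. -/
theorem tangentialPart_eq {f g : ℝ → ℝ} (hf : ∀ x, HasDerivAt f (g x) x) (hg : Continuous g)
    (u : ℝ) {ε : ℝ} (hε : 0 < ε) :
    tangentialPart g u ε =
      ∫ t in Set.Ioi 0, (f (u + t) - f (u - t)) * (2 * ε * t / (t ^ 2 + ε ^ 2) ^ 2) := by
  have h1 := integral_comp_mul_left_Ioi (fun t => ε * ((f (u + t) - f (u - t)) *
    (2 * ε * t / (t ^ 2 + ε ^ 2) ^ 2))) 0 hε
  rw [mul_zero, integral_const_mul, integral_const_mul, smul_eq_mul,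
    inv_mul_cancel_left₀ hε.ne'] at h1
  rw [← h1, ← integral_const_mul]
  refine setIntegral_congr_fun measurableSet_Ioi fun s hs => ?_
  have hs : 0 < s := hs
  rw [intervalMean_eq hf hg u (mul_pos hε hs).ne']
  have h2 : (ε * s) ^ 2 + ε ^ 2 = ε ^ 2 * (1 + s ^ 2) := by ring
  rw [h2]
  field_simp
  ring

theorem sub_ne_zero_of_im_pos {z : ℂ} (hz : 0 < z.im) (v : ℝ) : (v : ℂ) - z ≠ 0 := by
  intro h
  have := congrArg Complex.im h
  simp at this
  exact hz.ne' this

theorem im_le_norm_ofReal_sub {z : ℂ} (v : ℝ) : z.im ≤ ‖(v : ℂ) - z‖ := by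
  have := Complex.abs_im_le_norm ((v : ℂ) - z)
  simp at this
  exact (le_abs_self _).trans this

theorem norm_cauchy_integrand_le {f : ℝ → ℝ} {z : ℂ} {d : ℝ} (hd : 0 < d) (hz : d ≤ z.im)
    (n : ℕ) (v : ℝ) : ‖(f v : ℂ) / ((v : ℂ) - z) ^ n‖ ≤ (d ^ n)⁻¹ * ‖f v‖ := by
  rw [norm_div, norm_pow, Complex.norm_real, div_eq_inv_mul]
  have := hz.trans (im_le_norm_ofReal_sub (z := z) v)
  gcongr

theorem aestronglyMeasurable_cauchy_integrand {f : ℝ → ℝ} (hf : Integrable f) (z : ℂ) (n : ℕ) :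
    AEStronglyMeasurable fun v : ℝ => (f v : ℂ) / ((v : ℂ) - z) ^ n := by
  have h1 : AEMeasurable (fun v : ℝ => (f v : ℂ)) := hf.ofReal.aestronglyMeasurable.aemeasurable
  exact (h1.div (by fun_prop)).aestronglyMeasurable

theorem integrable_cauchy_integrand {f : ℝ → ℝ} (hf : Integrable f) {z : ℂ} (hz : 0 < z.im)
    (n : ℕ) : Integrable fun v : ℝ => (f v : ℂ) / ((v : ℂ) - z) ^ n :=
  (hf.norm.const_mul (z.im ^ n)⁻¹).mono' (aestronglyMeasurable_cauchy_integrand hf z n)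
    (ae_of_all _ fun v => norm_cauchy_integrand_le hz le_rfl n v)

theorem norm_integral_cauchy_le {f : ℝ → ℝ} (hf : Integrable f) {z : ℂ} (hz : 0 < z.im) (n : ℕ) :
    ‖∫ v : ℝ, (f v : ℂ) / ((v : ℂ) - z) ^ n‖ ≤ (z.im ^ n)⁻¹ * ∫ v, ‖f v‖ := by
  rw [← integral_const_mul]
  exact norm_integral_le_of_norm_le (hf.norm.const_mul _)
    (ae_of_all _ fun v => norm_cauchy_integrand_le hz le_rfl n v)

theorem differentiableAt_integral_cauchy_sq {f : ℝ → ℝ} (hf : Integrable f) {z : ℂ}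
    (hz : 0 < z.im) :
    DifferentiableAt ℂ (fun z => ∫ v : ℝ, (f v : ℂ) / ((v : ℂ) - z) ^ 2) z := by
  -- On the half plane `Im w > Im z / 2` the differentiated integrand has one integrable bound.
  have hd : 0 < z.im / 2 := by positivity
  have hs : {w : ℂ | z.im / 2 < w.im} ∈ 𝓝 z :=
    (isOpen_lt continuous_const Complex.continuous_im).mem_nhds (by
      simp only [Set.mem_ofPred_eq]; linarith)
  refine (hasDerivAt_integral_of_dominated_loc_of_deriv_le
    (F' := fun w v => 2 * ((f v : ℂ) / ((v : ℂ) - w) ^ 3))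
    (bound := fun v => 2 * (((z.im / 2) ^ 3)⁻¹ * ‖f v‖)) hs
    (Eventually.of_forall fun w => aestronglyMeasurable_cauchy_integrand hf w 2)
    (integrable_cauchy_integrand hf hz 2)
    ((aestronglyMeasurable_cauchy_integrand hf z 3).const_mul 2)
    (ae_of_all _ fun v w hw => ?_) ((hf.norm.const_mul _).const_mul 2)
    (ae_of_all _ fun v w hw => ?_)).2.differentiableAt
  · rw [norm_mul, Complex.norm_ofNat]
    gcongr
    exact norm_cauchy_integrand_le hd (le_of_lt hw) 3 v
  · have hw : 0 < w.im := hd.trans hw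
    have h0 := sub_ne_zero_of_im_pos hw v
    refine ((hasDerivAt_const w (f v : ℂ)).div (((hasDerivAt_id w).const_sub (v : ℂ)).pow 2)
      (pow_ne_zero 2 h0)).congr_deriv ?_
    simp
    field_simp

theorem integral_cauchy_sq_eq {f g b : ℝ → ℝ} (hf : ∀ x, HasDerivAt f (g x) x)
    (hg : Continuous g) (hfi : Integrable f) (hbi : IntegrableOn b (Set.Ioi 0))
    (hb : ∀ u, ∀ t > 0, |secondDiff f u t| * (t ^ 2)⁻¹ ≤ b t) {z : ℂ} (hz : 0 < z.im) :
    ∫ v : ℝ, (f v : ℂ) / ((v : ℂ) - z) ^ 2 =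
      (normalPart f z.re z.im : ℂ) + Complex.I * (tangentialPart g z.re z.im : ℂ) := by
  have hfc : Continuous f := continuous_iff_continuousAt.2 fun x => (hf x).continuousAt
  let φ : ℝ → ℂ := fun t => (f (z.re + t) : ℂ) / (((z.re + t : ℝ) : ℂ) - z) ^ 2
  have hφ : Integrable φ := (integrable_cauchy_integrand hfi hz 2).comp_add_left z.re
  have hk : ∀ t : ℝ, 1 / (((z.re + t : ℝ) : ℂ) - z) ^ 2 =
      (((t ^ 2 - z.im ^ 2) / (t ^ 2 + z.im ^ 2) ^ 2 : ℝ) : ℂ) +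
        ((2 * z.im * t / (t ^ 2 + z.im ^ 2) ^ 2 : ℝ) : ℂ) * Complex.I := by
    intro t
    have h0 := sub_ne_zero_of_im_pos hz (z.re + t)
    have h1 : ((z.re + t : ℝ) : ℂ) - z = t - z.im * Complex.I := by
      apply Complex.ext <;> simp
    rw [h1] at h0 ⊢
    have h2 : (t : ℂ) ^ 2 + (z.im : ℂ) ^ 2 ≠ 0 := by
      have : t ^ 2 + z.im ^ 2 ≠ 0 := by positivity
      exact_mod_cast this
    push_cast
    rw [div_mul_eq_mul_div, ← add_div, div_eq_div_iff (pow_ne_zero 2 h0) (pow_ne_zero 2 h2)]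
    have h3 : (t : ℂ) ^ 2 + (z.im : ℂ) ^ 2 = (t - z.im * Complex.I) * (t + z.im * Complex.I) := by
      linear_combination (z.im : ℂ) ^ 2 * Complex.I_sq
    rw [h3]
    linear_combination (t - z.im * Complex.I) ^ 2 * (z.im : ℂ) ^ 2 * Complex.I_sq
  -- Folding at `Re z` pairs the even kernel with the sum, and the odd kernel with the difference,
  -- of `f` at the points `Re z ± t`.
  have hsplit : ∫ v : ℝ, (f v : ℂ) / ((v : ℂ) - z) ^ 2 = ∫ t in Set.Ioi 0, (φ t + φ (-t)) := by
    have h1 : ∫ v : ℝ, (f v : ℂ) / ((v : ℂ) - z) ^ 2 = ∫ t, φ t :=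
      (integral_add_left_eq_self (fun v : ℝ => (f v : ℂ) / ((v : ℂ) - z) ^ 2) z.re).symm
    have h2 := integral_comp_neg_Ioi 0 φ
    rw [neg_zero] at h2
    rw [h1, integral_add hφ.integrableOn hφ.comp_neg.integrableOn, h2, add_comm,
      intervalIntegral.integral_Iic_add_Ioi hφ.integrableOn hφ.integrableOn]
  have hψ : IntegrableOn (fun t => φ t + φ (-t)) (Set.Ioi 0) :=
    (hφ.add hφ.comp_neg).integrableOn
  have hφk : ∀ t, φ t + φ (-t) =
      (((f (z.re + t) + f (z.re - t)) * ((t ^ 2 - z.im ^ 2) / (t ^ 2 + z.im ^ 2) ^ 2) : ℝ) : ℂ) +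
      (((f (z.re + t) - f (z.re - t)) * (2 * z.im * t / (t ^ 2 + z.im ^ 2) ^ 2) : ℝ) : ℂ) *
        Complex.I := by
    intro t
    have h1 := hk t
    have h2 := hk (-t)
    simp only [φ]
    rw [div_eq_mul_one_div, h1, div_eq_mul_one_div (f (z.re + -t) : ℂ), h2, neg_sq,
      ← sub_eq_add_neg]
    push_cast
    ring
  have hre := Complex.reCLM.integral_comp_comm hψ
  have him := Complex.imCLM.integral_comp_comm hψ
  rw [hsplit]
  apply Complex.ext
  · have h1 : (∫ t in Set.Ioi 0, (φ t + φ (-t))).re = ∫ t in Set.Ioi 0,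
        (f (z.re + t) + f (z.re - t)) * ((t ^ 2 - z.im ^ 2) / (t ^ 2 + z.im ^ 2) ^ 2) := by
      rw [← Complex.reCLM_apply, ← hre]
      refine setIntegral_congr_fun measurableSet_Ioi fun t _ => ?_
      simp only [hφk, Complex.reCLM_apply, Complex.add_re, Complex.ofReal_re, Complex.re_ofReal_mul,
        Complex.I_re, mul_zero, add_zero]
    have hi1 : IntegrableOn (fun t => secondDiff f z.re t *
        ((t ^ 2 - z.im ^ 2) / (t ^ 2 + z.im ^ 2) ^ 2)) (Set.Ioi 0) := by
      refine Integrable.mono' hbi (aestronglyMeasurable_normalPart_integrand hfc _ _ _) ?_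
      filter_upwards [ae_restrict_mem measurableSet_Ioi] with t ht
      exact norm_normalPart_integrand_le hb _ _ ht
    obtain ⟨hi2, hk0⟩ := integral_even_kernel hz
    have h2 := integral_add hi1 (hi2.const_mul (2 * f z.re))
    rw [integral_const_mul, hk0, mul_zero, add_zero] at h2
    rw [h1]
    simp only [Complex.add_re, Complex.ofReal_re, Complex.mul_re, Complex.I_re, Complex.I_im,
      Complex.ofReal_im, zero_mul, mul_zero, sub_zero, add_zero]
    rw [normalPart, ← h2]
    refine setIntegral_congr_fun measurableSet_Ioi fun t _ => ?_
    simp only [secondDiff]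
    ring
  · rw [← Complex.imCLM_apply, ← him]
    simp only [Complex.add_im, Complex.ofReal_re, Complex.mul_im, Complex.I_re, Complex.I_im,
      Complex.ofReal_im, zero_mul, one_mul, zero_add, tangentialPart_eq hf hg z.re hz]
    refine setIntegral_congr_fun measurableSet_Ioi fun t _ => ?_
    simp only [hφk, Complex.imCLM_apply, Complex.add_im, Complex.ofReal_im, Complex.im_ofReal_mul,
      Complex.I_im, mul_one, zero_add]

/-! ### Limits along horizontal strips. -/

theorem tendsto_cocompact_add_of_bounded {ι : Type*} {l : Filter ι} {u e : ι → ℝ} {B : ℝ}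
    (hu : Tendsto u l (cocompact ℝ)) (he : ∀ᶠ i in l, |e i| ≤ B) :
    Tendsto (fun i => u i + e i) l (cocompact ℝ) := by
  rw [← Metric.cobounded_eq_cocompact, ← tendsto_norm_atTop_iff_cobounded] at hu ⊢
  refine tendsto_atTop_mono' l ?_ (tendsto_atTop_add_const_right l (-B) hu)
  filter_upwards [he] with i hi
  have := norm_sub_le (u i + e i) (e i)
  rw [add_sub_cancel_right] at this
  rw [← Real.norm_eq_abs] at hi
  linarith

section
variable {ι : Type*} {l : Filter ι} [l.IsCountablyGenerated] {u e : ι → ℝ}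

theorem tendsto_normalPart_zero {f b : ℝ → ℝ} (hf : Continuous f)
    (hf0 : Tendsto f (cocompact ℝ) (𝓝 0)) (hbi : IntegrableOn b (Set.Ioi 0))
    (hb : ∀ u, ∀ t > 0, |secondDiff f u t| * (t ^ 2)⁻¹ ≤ b t) (hu : Tendsto u l (cocompact ℝ)) :
    Tendsto (fun i => normalPart f (u i) (e i)) l (𝓝 0) := by
  have h0 : Tendsto (fun i => normalPart f (u i) (e i)) l (𝓝 (∫ t in Set.Ioi (0 : ℝ), (0 : ℝ))) := by
    refine tendsto_integral_filter_of_dominated_convergence b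
      (Eventually.of_forall fun i => aestronglyMeasurable_normalPart_integrand hf _ _ _)
      (Eventually.of_forall fun i => ?_) hbi ?_
    · filter_upwards [ae_restrict_mem measurableSet_Ioi] with t ht
      exact norm_normalPart_integrand_le hb _ _ ht
    · filter_upwards [ae_restrict_mem measurableSet_Ioi] with t ht
      have h1 : Tendsto (fun i => secondDiff f (u i) t) l (𝓝 (0 + 0 - 2 * 0)) :=
        ((hf0.comp (tendsto_cocompact_add_of_bounded hu (e := fun _ => t)
          (Eventually.of_forall fun _ => le_rfl))).add
          (hf0.comp (tendsto_cocompact_add_of_bounded hu (e := fun _ => -t)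
          (Eventually.of_forall fun _ => le_rfl)))).sub ((hf0.comp hu).const_mul 2)
      have h2 : Tendsto (fun i => ‖secondDiff f (u i) t‖ * (t ^ 2)⁻¹) l (𝓝 0) := by
        simpa using h1.norm.mul_const (t ^ 2)⁻¹
      refine squeeze_zero_norm (fun i => ?_) h2
      rw [norm_mul]
      exact mul_le_mul_of_nonneg_left (abs_even_kernel_le ht _) (norm_nonneg _)
  simpa using h0

theorem tendsto_tangentialPart_zero {g : ℝ → ℝ} {M B : ℝ} (hg : Continuous g)
    (hM : ∀ x, |g x| ≤ M) (hg0 : Tendsto g (cocompact ℝ) (𝓝 0))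
    (hu : Tendsto u l (cocompact ℝ)) (he : ∀ᶠ i in l, |e i| ≤ B) :
    Tendsto (fun i => tangentialPart g (u i) (e i)) l (𝓝 0) := by
  have hmean : ∀ s : ℝ, Tendsto (fun i => intervalMean g (u i) (e i * s)) l (𝓝 0) := by
    intro s
    have h0 : Tendsto (fun i => intervalMean g (u i) (e i * s)) l
        (𝓝 (∫ r in (-1 : ℝ)..1, (0 : ℝ))) := by
      refine intervalIntegral.tendsto_integral_filter_of_dominated_convergence (fun _ => M / 2)
        (Eventually.of_forall fun i => Continuous.aestronglyMeasurable (by fun_prop))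
        (Eventually.of_forall fun i => ae_of_all _ fun r _ => ?_)
        intervalIntegrable_const (ae_of_all _ fun r _ => ?_)
      · rw [Real.norm_eq_abs, abs_div, abs_two]
        have := hM (u i + e i * s * r)
        gcongr
      · have h1 := (hg0.comp (tendsto_cocompact_add_of_bounded hu (e := fun i => e i * s * r)
          (B := B * |s| * |r|) (by
            filter_upwards [he] with i hi
            rw [abs_mul, abs_mul]
            gcongr))).div_const 2
        simpa using h1
    simpa using h0
  have hc := continuous_intervalMean hg
  have h0 : Tendsto (fun i => tangentialPart g (u i) (e i)) l
      (𝓝 (∫ s in Set.Ioi (0 : ℝ), (0 : ℝ))) := by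
    refine tendsto_integral_filter_of_dominated_convergence
      (fun s => M * (4 * s ^ 2 / (1 + s ^ 2) ^ 2))
      (Eventually.of_forall fun i => ?_) (Eventually.of_forall fun i => ae_of_all _ fun s => ?_)
      (integrableOn_odd_kernel.const_mul M) (ae_of_all _ fun s => ?_)
    · refine Continuous.aestronglyMeasurable (Continuous.mul ?_ (Continuous.div (by fun_prop)
        (by fun_prop) fun s => by positivity))
      exact hc.comp (f := fun s => (u i, e i * s)) (by fun_prop)
    · rw [norm_mul, Real.norm_of_nonneg (r := 4 * s ^ 2 / (1 + s ^ 2) ^ 2) (by positivity)]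
      gcongr
      exact abs_intervalMean_le hM _ _
    · simpa using (hmean s).mul_const (4 * s ^ 2 / (1 + s ^ 2) ^ 2)
  simpa using h0

end

/-! ### The dispersion function: continuity, holomorphy, limit at infinity. -/

/-- The plasma dispersion function of the profile `f` with derivative `g` on the closed upper half
plane, written so as to be continuous up to the real axis. -/
noncomputable def dispersionFunction (f g : ℝ → ℝ) (z : ℂ) : ℂ :=
  1 - (Real.pi : ℂ)⁻¹ *
    ((normalPart f z.re z.im : ℂ) + Complex.I * (tangentialPart g z.re z.im : ℂ))

namespace IsRegularProfile

variable {f g : ℝ → ℝ}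

theorem continuous (h : IsRegularProfile f g) : Continuous f :=
  continuous_iff_continuousAt.2 fun x => (h.hasDerivAt x).continuousAt

theorem continuous_dispersionFunction (h : IsRegularProfile f g) :
    Continuous (dispersionFunction f g) := by
  obtain ⟨b, hbi, hb⟩ := h.exists_dominating
  obtain ⟨M, hM⟩ := exists_norm_le_of_tendsto_zero_cocompact h.continuous_deriv
    h.tendsto_deriv_zero
  have h1 : Continuous fun z : ℂ => normalPart f z.re z.im :=
    (continuous_normalPart h.continuous hbi hb).comp (f := fun z : ℂ => (z.re, z.im))
      (by fun_prop)
  have h2 : Continuous fun z : ℂ => tangentialPart g z.re z.im :=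
    (continuous_tangentialPart h.continuous_deriv hM).comp (f := fun z : ℂ => (z.re, z.im))
      (by fun_prop)
  unfold dispersionFunction
  fun_prop

theorem dispersionFunction_eq (h : IsRegularProfile f g) {z : ℂ} (hz : 0 < z.im) :
    dispersionFunction f g z =
      1 - (Real.pi : ℂ)⁻¹ * ∫ v : ℝ, (f v : ℂ) / ((v : ℂ) - z) ^ 2 := by
  obtain ⟨b, hbi, hb⟩ := h.exists_dominating
  rw [dispersionFunction,
    integral_cauchy_sq_eq h.hasDerivAt h.continuous_deriv h.integrable hbi hb hz]

theorem differentiableAt_dispersionFunction (h : IsRegularProfile f g) {z : ℂ} (hz : 0 < z.im) :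
    DifferentiableAt ℂ (dispersionFunction f g) z := by
  refine (((differentiableAt_integral_cauchy_sq h.integrable hz).const_mul
    (Real.pi : ℂ)⁻¹).const_sub 1).congr_of_eventuallyEq ?_
  filter_upwards [(isOpen_lt continuous_const Complex.continuous_im).mem_nhds hz] with w hw
  exact h.dispersionFunction_eq hw

theorem tendsto_dispersionFunction_strip (h : IsRegularProfile f g) (B : ℝ) :
    Tendsto (dispersionFunction f g) (cocompact ℂ ⊓ 𝓟 {z | |z.im| ≤ B}) (𝓝 1) := by
  obtain ⟨b, hbi, hb⟩ := h.exists_dominating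
  obtain ⟨M, hM⟩ := exists_norm_le_of_tendsto_zero_cocompact h.continuous_deriv
    h.tendsto_deriv_zero
  have : (cocompact ℂ).IsCountablyGenerated := by
    rw [← Metric.cobounded_eq_cocompact, ← comap_norm_atTop]
    infer_instance
  have him : ∀ᶠ z : ℂ in cocompact ℂ ⊓ 𝓟 {z | |z.im| ≤ B}, |z.im| ≤ B :=
    mem_inf_of_right (mem_principal_self _)
  have hre : Tendsto Complex.re (cocompact ℂ ⊓ 𝓟 {z | |z.im| ≤ B}) (cocompact ℝ) := by
    rw [← Metric.cobounded_eq_cocompact (α := ℝ), ← tendsto_norm_atTop_iff_cobounded]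
    have hn : Tendsto (fun z : ℂ => ‖z‖ + -B) (cocompact ℂ ⊓ 𝓟 {z | |z.im| ≤ B}) atTop :=
      tendsto_atTop_add_const_right _ _
        ((tendsto_norm_cocompact_atTop (E := ℂ)).mono_left inf_le_left)
    refine tendsto_atTop_mono' _ ?_ hn
    filter_upwards [him] with z hz
    have := Complex.norm_le_abs_re_add_abs_im z
    rw [Real.norm_eq_abs]
    linarith
  have h1 := tendsto_normalPart_zero (e := Complex.im) h.continuous h.tendsto_zero hbi hb hre
  have h2 := tendsto_tangentialPart_zero h.continuous_deriv hM h.tendsto_deriv_zero hre him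
  have h3 := (((Complex.continuous_ofReal.tendsto 0).comp h1).add
    (((Complex.continuous_ofReal.tendsto 0).comp h2).const_mul Complex.I)).const_mul
      (Real.pi : ℂ)⁻¹ |>.const_sub 1
  simp only [Function.comp_def, Complex.ofReal_zero, mul_zero, add_zero, sub_zero] at h3
  exact h3

/-- Above height `B` the Cauchy integral is at most `‖f‖₁ / B²`, small for large `B`; the remaining
strip is handled by dominated convergence. -/
theorem tendsto_dispersionFunction (h : IsRegularProfile f g) :
    Tendsto (dispersionFunction f g) (cocompact ℂ ⊓ 𝓟 {z | 0 ≤ z.im}) (𝓝 1) := by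
  rw [Metric.tendsto_nhds]
  intro δ hδ
  have hB : Tendsto (fun B : ℝ => Real.pi⁻¹ * ((B ^ 2)⁻¹ * ∫ v, ‖f v‖)) atTop (𝓝 0) := by
    have := ((tendsto_inv_atTop_zero.comp (tendsto_pow_atTop (α := ℝ) two_ne_zero)).mul_const
      (∫ v, ‖f v‖)).const_mul Real.pi⁻¹
    simpa using this
  obtain ⟨B, hB, hB0⟩ := ((hB.eventually (gt_mem_nhds hδ)).and (eventually_gt_atTop 0)).exists
  have h1 := Metric.tendsto_nhds.1 (h.tendsto_dispersionFunction_strip B) δ hδ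
  rw [eventually_inf_principal] at h1 ⊢
  filter_upwards [h1] with z hz1 hz0
  rcases le_or_gt z.im B with hzB | hzB
  · exact hz1 ((abs_of_nonneg (show 0 ≤ z.im from hz0)).le.trans hzB)
  · have hz : 0 < z.im := hB0.trans hzB
    rw [h.dispersionFunction_eq hz, dist_eq_norm, sub_sub_cancel_left, norm_neg, norm_mul,
      norm_inv, Complex.norm_real, Real.norm_of_nonneg Real.pi_pos.le]
    refine lt_of_le_of_lt ?_ hB
    gcongr
    refine (norm_integral_cauchy_le h.integrable hz 2).trans ?_
    have : 0 ≤ ∫ v, ‖f v‖ := integral_nonneg fun v => norm_nonneg _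
    gcongr

theorem hasHilbertTransformAt (h : IsRegularProfile f g) (u : ℝ) :
    HasHilbertTransformAt g u (hilbertTransform g u) := by
  obtain ⟨b, hbi, hb⟩ := h.exists_dominating
  have := hasHilbertTransformAt_normalPart h.hasDerivAt h.continuous_deriv h.tendsto_zero hbi hb u
  rwa [this.hilbertTransform_eq]

theorem dispersionFunction_ofReal (h : IsRegularProfile f g) (u : ℝ) :
    dispersionFunction f g u = penrosePlot g u := by
  obtain ⟨b, hbi, hb⟩ := h.exists_dominating
  have := hasHilbertTransformAt_normalPart h.hasDerivAt h.continuous_deriv h.tendsto_zero hbi hb u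
  change _ = 1 - (hilbertTransform g u : ℂ) - Complex.I * (g u : ℂ)
  rw [this.hilbertTransform_eq, dispersionFunction, Complex.ofReal_re, Complex.ofReal_im,
    tangentialPart_zero]
  have hpi : (Real.pi : ℂ) ≠ 0 := by exact_mod_cast Real.pi_ne_zero
  push_cast
  field_simp
  ring

end IsRegularProfile

/-! ### Transport to the disc. -/

/-- The inverse Cayley transform, from the unit disc to the upper half plane. -/
noncomputable def inverseCayley (w : ℂ) : ℂ := Complex.I * (1 + w) / (1 - w)

theorem inverseCayley_im (w : ℂ) : (inverseCayley w).im = (1 - ‖w‖ ^ 2) / ‖1 - w‖ ^ 2 := by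
  rw [← Complex.normSq_eq_norm_sq, ← Complex.normSq_eq_norm_sq, inverseCayley, Complex.div_im]
  simp [Complex.normSq_apply]
  ring

theorem inverseCayley_cayleyCircle (u : ℝ) : inverseCayley (cayleyCircle u) = u := by
  have h0 := ofReal_add_I_ne_zero u
  have h1 : 1 - cayleyCircle u = 2 * Complex.I / (u + Complex.I) := by
    rw [cayleyCircle_coe]; field_simp; ring
  have h2 : 1 + cayleyCircle u = 2 * u / (u + Complex.I) := by
    rw [cayleyCircle_coe]; field_simp; ring
  have := Complex.I_ne_zero
  rw [inverseCayley, h1, h2]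
  field_simp

theorem cayleyCircle_coe_ne_one (u : ℝ) : cayleyCircle u ≠ 1 := by
  have h0 := ofReal_add_I_ne_zero u
  rw [cayleyCircle_coe, Ne, div_eq_one_iff_eq h0]
  intro h
  have := congrArg Complex.im h
  norm_num at this

theorem exists_cayleyCircle_eq {w : ℂ} (hw : ‖w‖ = 1) : ∃ x, cayleyCircle x = w := by
  by_cases h1 : w = 1
  · exact ⟨OnePoint.infty, h1.symm⟩
  · refine ⟨((inverseCayley w).re : ℝ), ?_⟩
    have him : (((inverseCayley w).re : ℝ) : ℂ) = inverseCayley w := by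
      apply Complex.ext
      · simp
      · rw [inverseCayley_im, hw]; simp
    have h2 : 1 - w ≠ 0 := sub_ne_zero.2 (Ne.symm h1)
    have h0 := ofReal_add_I_ne_zero (inverseCayley w).re
    rw [cayleyCircle_coe, div_eq_iff h0, him, inverseCayley]
    field_simp
    ring

theorem tendsto_inverseCayley :
    Tendsto inverseCayley (𝓝[Metric.closedBall 0 1 \ {1}] 1) (cocompact ℂ ⊓ 𝓟 {z | 0 ≤ z.im}) := by
  rw [tendsto_inf, tendsto_principal]
  constructor
  · rw [← Metric.cobounded_eq_cocompact]
    have h1 : Tendsto (fun w : ℂ => 1 - w) (𝓝[≠] 1) (𝓝[≠] 0) := by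
      rw [tendsto_nhdsWithin_iff]
      constructor
      · have : Tendsto (fun w : ℂ => 1 - w) (𝓝 1) (𝓝 (1 - 1)) :=
          tendsto_const_nhds.sub tendsto_id
        rw [sub_self] at this
        exact this.mono_left nhdsWithin_le_nhds
      · filter_upwards [self_mem_nhdsWithin] with w hw
        exact sub_ne_zero.2 (Ne.symm hw)
    -- Partial fractions: `i(1 + w)/(1 - w) = 2i/(1 - w) - i`.
    have h2 : Tendsto (fun w : ℂ => 2 * Complex.I * (1 - w)⁻¹ + -Complex.I) (𝓝[≠] 1)
        (Bornology.cobounded ℂ) :=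
      (tendsto_add_const_cobounded (-Complex.I)).comp ((tendsto_mul_left_cobounded (by simp)).comp
        (tendsto_inv₀_nhdsNE_zero.comp h1))
    have h3 : Tendsto inverseCayley (𝓝[≠] 1) (Bornology.cobounded ℂ) := by
      refine h2.congr' ?_
      filter_upwards [self_mem_nhdsWithin] with w hw
      have : 1 - w ≠ 0 := sub_ne_zero.2 (Ne.symm hw)
      rw [inverseCayley]
      field_simp
      ring
    exact h3.mono_left (nhdsWithin_mono _ fun w hw => hw.2)
  · filter_upwards [self_mem_nhdsWithin] with w hw
    have : ‖w‖ ≤ 1 := mem_closedBall_zero_iff.1 hw.1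
    rw [inverseCayley_im]
    exact div_nonneg (by nlinarith [norm_nonneg w]) (by positivity)

/-- The dispersion function transported to the closed unit disc, with the value `1` at `1`. -/
noncomputable def discDispersion (f g : ℝ → ℝ) : ℂ → ℂ :=
  Function.update (dispersionFunction f g ∘ inverseCayley) 1 1

namespace IsRegularProfile

variable {f g : ℝ → ℝ}

theorem discDispersion_cayleyCircle (h : IsRegularProfile f g) (x : OnePoint ℝ) :
    discDispersion f g (cayleyCircle x) = penrosePlot g x := by
  induction x using OnePoint.rec with
  | infty => simp [discDispersion, cayleyCircle_infty]; rfl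
  | coe u =>
    rw [discDispersion, Function.update_of_ne (cayleyCircle_coe_ne_one u), Function.comp_apply,
      inverseCayley_cayleyCircle, h.dispersionFunction_ofReal]

theorem continuousOn_discDispersion (h : IsRegularProfile f g) :
    ContinuousOn (discDispersion f g) (Metric.closedBall 0 1) := by
  intro w hw
  by_cases h1 : w = 1
  · subst h1
    rw [discDispersion, continuousWithinAt_update_same]
    exact h.tendsto_dispersionFunction.comp tendsto_inverseCayley
  · rw [discDispersion, continuousWithinAt_update_of_ne h1]
    refine (h.continuous_dispersionFunction.continuousAt.comp ?_).continuousWithinAt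
    exact ContinuousAt.div (by fun_prop) (by fun_prop) (sub_ne_zero.2 (Ne.symm h1))

theorem differentiableOn_discDispersion (h : IsRegularProfile f g) :
    DifferentiableOn ℂ (discDispersion f g) (Metric.ball 0 1) := by
  intro w hw
  have hw1 : ‖w‖ < 1 := mem_ball_zero_iff.1 hw
  have h1 : w ≠ 1 := by
    rintro rfl
    simp at hw1
  have h2 : 1 - w ≠ 0 := sub_ne_zero.2 (Ne.symm h1)
  have him : 0 < (inverseCayley w).im := by
    rw [inverseCayley_im]
    have := norm_pos_iff.2 h2
    exact div_pos (by nlinarith [norm_nonneg w]) (by positivity)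
  have h3 : DifferentiableAt ℂ (dispersionFunction f g ∘ inverseCayley) w := by
    refine (h.differentiableAt_dispersionFunction him).comp w ?_
    exact DifferentiableAt.div (by fun_prop) (by fun_prop) h2
  refine (h3.congr_of_eventuallyEq ?_).differentiableWithinAt
  filter_upwards [isOpen_ne.mem_nhds h1] with v hv
  exact Function.update_of_ne hv _ _

theorem continuous_penrosePlot (h : IsRegularProfile f g) : Continuous (penrosePlot g) := by
  rw [← funext h.discDispersion_cayleyCircle]
  exact h.continuousOn_discDispersion.comp_continuous continuous_cayleyCircle fun x =>
    mem_closedBall_zero_iff.2 (norm_cayleyCircle x).le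

theorem exists_hasWindingNumber_penrosePlot (h : IsRegularProfile f g)
    (h0 : ∀ u : ℝ, penrosePlot g u ≠ 0) : ∃ n : ℕ, HasWindingNumber (penrosePlot g) 0 n := by
  rw [← funext h.discDispersion_cayleyCircle]
  refine exists_hasWindingNumber_comp_cayleyCircle h.continuousOn_discDispersion
    h.differentiableOn_discDispersion fun w hw => ?_
  obtain ⟨x, rfl⟩ := exists_cayleyCircle_eq (mem_sphere_zero_iff_norm.1 hw)
  rw [h.discDispersion_cayleyCircle]
  induction x using OnePoint.rec with
  | infty => exact one_ne_zero
  | coe u => exact h0 u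

theorem penrosePlot_winding (h : IsRegularProfile f g) :
    Continuous (penrosePlot g) ∧ ((∀ u : ℝ, penrosePlot g u ≠ 0) →
      (∃! n : ℤ, HasWindingNumber (penrosePlot g) 0 n) ∧
        ∀ n : ℤ, HasWindingNumber (penrosePlot g) 0 n → 0 ≤ n) := by
  refine ⟨h.continuous_penrosePlot, fun h0 => ?_⟩
  obtain ⟨n, hn⟩ := h.exists_hasWindingNumber_penrosePlot h0
  exact ⟨⟨n, hn, fun m hm => hm.unique hn⟩, fun m hm => hm.unique hn ▸ Int.natCast_nonneg n⟩

end IsRegularProfile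

/-! ### The opposite convention and the conclusion. -/

theorem truncatedHilbert_neg (g : ℝ → ℝ) (u ε R : ℝ) :
    truncatedHilbert (-g) u ε R = -truncatedHilbert g u ε R := by
  simp only [truncatedHilbert, Pi.neg_apply, neg_div, integral_neg, mul_neg]

/-- Both signs change together, so the second curve is the first one for the profile `-f`. Existence
of the principal value is needed, as `hilbertTransform` is a `limUnder`. -/
theorem penrosePlot'_eq_penrosePlot_neg {g : ℝ → ℝ}
    (hg : ∀ u, HasHilbertTransformAt g u (hilbertTransform g u)) :
    penrosePlot' g = penrosePlot (-g) := by
  have hneg : ∀ u, hilbertTransform (-g) u = -hilbertTransform g u := fun u =>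
    HasHilbertTransformAt.hilbertTransform_eq (by
      simpa only [HasHilbertTransformAt, truncatedHilbert_neg] using Tendsto.neg (hg u))
  rw [penrosePlot', penrosePlot]
  congr 1
  ext u
  rw [hneg, Pi.neg_apply, Complex.ofReal_neg (g u)]
  ring

theorem mainTheorem7 (f₀ : ℝ → ℝ) (hf₀ : Integrable f₀) (hdiff : Differentiable ℝ f₀)
    (C α : ℝ≥0) (hα : 0 < α) (hHolder : HolderWith C α (deriv f₀)) :
    (∀ u : ℝ, HasHilbertTransformAt (deriv f₀) u (hilbertTransform (deriv f₀) u)) ∧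
    (Continuous (penrosePlot (deriv f₀)) ∧
      ((∀ u : ℝ, penrosePlot (deriv f₀) u ≠ 0) →
        (∃! n : ℤ, HasWindingNumber (penrosePlot (deriv f₀)) 0 n) ∧
        ∀ n : ℤ, HasWindingNumber (penrosePlot (deriv f₀)) 0 n → 0 ≤ n)) ∧
    (Continuous (penrosePlot' (deriv f₀)) ∧
      ((∀ u : ℝ, penrosePlot' (deriv f₀) u ≠ 0) →
        (∃! n : ℤ, HasWindingNumber (penrosePlot' (deriv f₀)) 0 n) ∧
        ∀ n : ℤ, HasWindingNumber (penrosePlot' (deriv f₀)) 0 n → 0 ≤ n)) := by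
  have h := isRegularProfile_of_holderWith hf₀ hdiff hα hHolder
  have hd : deriv (-f₀) = -deriv f₀ := funext fun x => deriv.neg
  have h' : IsRegularProfile (-f₀) (-deriv f₀) := by
    rw [← hd]
    refine isRegularProfile_of_holderWith (C := C) hf₀.neg hdiff.neg hα fun x y => ?_
    rw [hd]
    simpa only [Pi.neg_apply, edist_neg_neg] using hHolder x y
  refine ⟨h.hasHilbertTransformAt, h.penrosePlot_winding, ?_⟩
  rw [penrosePlot'_eq_penrosePlot_neg h.hasHilbertTransformAt]
  exact h'.penrosePlot_winding
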